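/- Let $M$ be a complete Riemannian $n$-manifold with Levi-Civita connection $\nabla$ and curvature tensor $R$, let $k\ge 1$ be an integer, and let $\gamma:\mathbb{R}\to M$ be a unit speed geodesic. Write $J'$ for the covariant derivative along $\gamma$ of a vector field $J$ along $\gamma$. We say $Ric_k(\dot\gamma)\ge 0$ (respectively $>0$) if for every $t\in\mathbb{R}$ and every orthonormal $(k+1)$-frame $\{\dot\gamma(t),w_1,\dots,w_k\}$ in $T_{\gamma(t)}M$ one has $\sum_{i=1}^k \sec(\dot\gamma(t),w_i)\ge 0$ (respectively $>0$). Suppose $Ric_k(\dot\gamma)\ge 0$, and let $\Lambda$ be an $(n-1)$-dimensional vector space of Jacobi fields along $\gamma$ (solutions of $J''+R(J,\dot\gamma)\dot\gamma=0$), all pointwise orthogonal to $\dot\gamma$, on which the Riccati operator $S:J\mapsto J'$ is self-adjoint, i.e. $\langle J_1'(t),J_2(t)\rangle=\langle J_1(t),J_2'(t)\rangle$ for all $J_1,J_2\in\Lambda$ and all $t$. Put $$\mathcal{Z}=\mathrm{span}\{J\in\Lambda \mid J(t)=0\text{ for some }t\in\mathbb{R}\},\qquad \mathcal{P}=\{J\in\Lambda\mid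 J\text{ is parallel}\}.$$ 1. If $\dim\mathcal{Z}\le n-k-1$, then $\Lambda$ splits orthogonally as $\Lambda=\mathcal{Z}\oplus\mathcal{P}$; that is, $\Lambda=\mathcal{Z}+\mathcal{P}$, $\mathcal{Z}\cap\mathcal{P}=0$, and $\langle Z(t),P(t)\rangle=0$ for all $Z\in\mathcal{Z}$, $P\in\mathcal{P}$ and $t\in\mathbb{R}$. 2. If moreover $Ric_k(\dot\gamma)>0$ (without assuming the dimension bound of part 1), then $\dim\mathcal{Z}\ge n-k$. -/

import Mathlib

open scoped Manifold ContDiff Bundle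

noncomputable section

namespace JacobiSplitting

section Coordinates

variable {n : ℕ} {M : Type*} [TopologicalSpace M] [ChartedSpace (EuclideanSpace ℝ (Fin n)) M]
  [IsManifold (𝓡 n) ∞ M]

/-- The components of a tangent vector at `x` in the coordinate frame of the chart around `x₀`
(meaningful when `x` lies in the domain of that chart). -/
def coord (x₀ x : M) : TangentSpace (𝓡 n) x →L[ℝ] EuclideanSpace ℝ (Fin n) :=
  (trivializationAt (EuclideanSpace ℝ (Fin n)) (TangentSpace (𝓡 n) : M → Type _) x₀)
    |>.continuousLinearMapAt ℝ x

/-- The tangent vector at `x` with given components in the coordinate frame of the chart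
around `x₀`. -/
def ofCoord (x₀ x : M) : EuclideanSpace ℝ (Fin n) →L[ℝ] TangentSpace (𝓡 n) x :=
  (trivializationAt (EuclideanSpace ℝ (Fin n)) (TangentSpace (𝓡 n) : M → Type _) x₀)
    |>.symmL ℝ x

/-- The partial derivative `∂ᵢ f` at `y`. -/
def partialDeriv (i : Fin n) (f : EuclideanSpace ℝ (Fin n) → ℝ)
    (y : EuclideanSpace ℝ (Fin n)) : ℝ :=
  fderiv ℝ f y (EuclideanSpace.single i 1)

/-- The velocity `γ̇(t)` of a curve. -/
def velocity (n : ℕ) {M : Type*} [TopologicalSpace M]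
    [ChartedSpace (EuclideanSpace ℝ (Fin n)) M] (γ : ℝ → M) (t : ℝ) : TangentSpace (𝓡 n) (γ t) :=
  mfderiv 𝓘(ℝ, ℝ) (𝓡 n) γ t (1 : ℝ)

variable [Bundle.RiemannianBundle (fun x : M => TangentSpace (𝓡 n) x)]

/-- The matrix `(g_ij)` of the Riemannian metric in the chart around `x₀`, as a function of the
coordinates `y`. -/
def metricMatrix (x₀ : M) (y : EuclideanSpace ℝ (Fin n)) : Matrix (Fin n) (Fin n) ℝ :=
  Matrix.of fun i j =>
    inner ℝ
      (ofCoord x₀ ((extChartAt (𝓡 n) x₀).symm y) (EuclideanSpace.single i 1))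
      (ofCoord x₀ ((extChartAt (𝓡 n) x₀).symm y) (EuclideanSpace.single j 1))

/-- The Christoffel symbol `Γ^k_ij` of the Levi-Civita connection in the chart around `x₀`. -/
def christoffel (x₀ : M) (k i j : Fin n) (y : EuclideanSpace ℝ (Fin n)) : ℝ :=
  (1 / 2) * ∑ l, (metricMatrix x₀ y)⁻¹ k l *
    (partialDeriv i (fun z => metricMatrix x₀ z j l) y
      + partialDeriv j (fun z => metricMatrix x₀ z i l) y
      - partialDeriv l (fun z => metricMatrix x₀ z i j) y)

/-- The component along `∂_l` of `R(∂ᵢ, ∂ⱼ)∂_k` in the chart around `x₀`, where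
`R(X, Y)Z = ∇_X ∇_Y Z - ∇_Y ∇_X Z - ∇_[X,Y] Z`. -/
def curvatureCoeff (x₀ : M) (l i j k : Fin n) (y : EuclideanSpace ℝ (Fin n)) : ℝ :=
  partialDeriv i (christoffel x₀ l j k) y - partialDeriv j (christoffel x₀ l i k) y
    + ∑ m, (christoffel x₀ l i m y * christoffel x₀ m j k y
      - christoffel x₀ l j m y * christoffel x₀ m i k y)

/-- The curvature tensor `R(u, v)w` at `x`, computed in the chart around `x₀`. For `x` in the
domain of that chart the value does not depend on `x₀`. -/
def curvature (x₀ x : M) (u v w : TangentSpace (𝓡 n) x) : TangentSpace (𝓡 n) x :=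
  ofCoord x₀ x (WithLp.toLp 2 fun l =>
    ∑ i, ∑ j, ∑ k, curvatureCoeff x₀ l i j k (extChartAt (𝓡 n) x₀ x)
      * coord x₀ x u i * coord x₀ x v j * coord x₀ x w k)

/-- The sectional curvature of the plane spanned by `v` and `w`, computed in the chart
around `x₀`. -/
def sectionalCurvature (x₀ x : M) (v w : TangentSpace (𝓡 n) x) : ℝ :=
  inner ℝ (curvature x₀ x w v v) w / (inner ℝ v v * inner ℝ w w - inner ℝ v w ^ 2)

/-- `W` is the covariant derivative `V'` of the vector field `V` along the curve `γ`: in every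
chart, `W^k = dV^k/dt + Γ^k_ij γ̇^i V^j`. -/
def IsCovDerivAlong (γ : ℝ → M) (V W : ∀ t, TangentSpace (𝓡 n) (γ t)) : Prop :=
  ∀ (x₀ : M) (t : ℝ), γ t ∈ (chartAt (EuclideanSpace ℝ (Fin n)) x₀).source → ∀ k : Fin n,
    HasDerivAt (fun s => coord x₀ (γ s) (V s) k)
      (coord x₀ (γ t) (W t) k - ∑ i, ∑ j, christoffel x₀ k i j (extChartAt (𝓡 n) x₀ (γ t))
        * coord x₀ (γ t) (velocity n γ t) i * coord x₀ (γ t) (V t) j) t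

variable (n) in
/-- `γ : ℝ → M` is a geodesic of unit speed. -/
def IsUnitSpeedGeodesic (γ : ℝ → M) : Prop :=
  ContMDiff 𝓘(ℝ, ℝ) (𝓡 n) ∞ γ ∧ IsCovDerivAlong γ (velocity n γ) 0 ∧
    ∀ t, ‖velocity n γ t‖ = 1

/-- `J` is a Jacobi field along `γ`: `J'' + R(J, γ̇)γ̇ = 0` (the curvature term may be computed in
any chart). -/
def IsJacobiField (γ : ℝ → M) (J : ∀ t, TangentSpace (𝓡 n) (γ t)) : Prop :=
  ∃ W A : ∀ t, TangentSpace (𝓡 n) (γ t), IsCovDerivAlong γ J W ∧ IsCovDerivAlong γ W A ∧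
    ∀ (x₀ : M) (t : ℝ), γ t ∈ (chartAt (EuclideanSpace ℝ (Fin n)) x₀).source →
      A t + curvature x₀ (γ t) (J t) (velocity n γ t) (velocity n γ t) = 0

variable (n) in
/-- `Ric_k(γ̇) ≥ 0`: the sum of sectional curvatures `∑ sec(γ̇(t), wᵢ)` is nonnegative for every
orthonormal `(k+1)`-frame `γ̇(t), w₁, …, w_k`. -/
def RicNonneg (k : ℕ) (γ : ℝ → M) : Prop :=
  ∀ (t : ℝ) (w : Fin k → TangentSpace (𝓡 n) (γ t)),
    Orthonormal ℝ (Fin.cons (velocity n γ t) w : Fin (k + 1) → TangentSpace (𝓡 n) (γ t)) →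
    ∀ x₀ : M, γ t ∈ (chartAt (EuclideanSpace ℝ (Fin n)) x₀).source →
      0 ≤ ∑ i, sectionalCurvature x₀ (γ t) (velocity n γ t) (w i)

variable (n) in
/-- `Ric_k(γ̇) > 0`. -/
def RicPos (k : ℕ) (γ : ℝ → M) : Prop :=
  ∀ (t : ℝ) (w : Fin k → TangentSpace (𝓡 n) (γ t)),
    Orthonormal ℝ (Fin.cons (velocity n γ t) w : Fin (k + 1) → TangentSpace (𝓡 n) (γ t)) →
    ∀ x₀ : M, γ t ∈ (chartAt (EuclideanSpace ℝ (Fin n)) x₀).source →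
      0 < ∑ i, sectionalCurvature x₀ (γ t) (velocity n γ t) (w i)

/-- The Riccati operator `S : J ↦ J'` is self-adjoint on `Λ`: `⟨J₁', J₂⟩ = ⟨J₁, J₂'⟩` at all
times. -/
def RiccatiSelfAdjoint (γ : ℝ → M) (Λ : Submodule ℝ (∀ t, TangentSpace (𝓡 n) (γ t))) : Prop :=
  ∀ J₁ ∈ Λ, ∀ J₂ ∈ Λ, ∀ W₁ W₂ : ∀ t, TangentSpace (𝓡 n) (γ t),
    IsCovDerivAlong γ J₁ W₁ → IsCovDerivAlong γ J₂ W₂ →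
    ∀ t, inner ℝ (W₁ t) (J₂ t) = inner ℝ (J₁ t) (W₂ t)

/-- The span of the fields in `Λ` that vanish at some time. -/
def vanishingSpan (γ : ℝ → M) (Λ : Submodule ℝ (∀ t, TangentSpace (𝓡 n) (γ t))) :
    Submodule ℝ (∀ t, TangentSpace (𝓡 n) (γ t)) :=
  Submodule.span ℝ {J | J ∈ Λ ∧ ∃ t, J t = 0}

/-- The space of parallel vector fields along `γ`. -/
def parallelFields (γ : ℝ → M) : Submodule ℝ (∀ t, TangentSpace (𝓡 n) (γ t)) where
  carrier := {V | IsCovDerivAlong γ V 0}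
  zero_mem' := by
    intro x₀ t _ k
    simpa using hasDerivAt_const t (0 : ℝ)
  add_mem' := by
    intro V W hV hW x₀ t ht k
    have h := (hV x₀ t ht k).add (hW x₀ t ht k)
    refine (h.congr_deriv ?_).congr_of_eventuallyEq (.of_forall fun s => ?_)
    · simp [mul_add, Finset.sum_add_distrib]
      ring
    · simp
  smul_mem' := by
    intro c V hV x₀ t ht k
    have h := (hV x₀ t ht k).const_mul c
    refine (h.congr_deriv ?_).congr_of_eventuallyEq (.of_forall fun s => ?_)
    · simp [Finset.mul_sum, mul_left_comm]
    · simp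

end Coordinates

end JacobiSplitting

end

/-! Let `Z` be the span of the vanishing fields and `m = dim Λ - dim Z`. At time `t` the vertical
space `V_t` is spanned by the values of `Z` and by the derivatives of the fields of `Z` vanishing at
`t`. Self-adjointness makes these two pieces orthogonal, so `V_t` has dimension `dim Z` at every
time and varies continuously (`finrank_vert`, `eventually_vert_eq_span`). Project a basis of a
complement of `Z` onto the orthogonal space of `V_t`; the Gram determinant of the projections
(`horVolume`) never vanishes, because every field with a zero lies in `Z`.

The core is that `u = vol^(1/m)` of this horizontal volume is concave in the barrier sense, which
replaces the transverse Jacobi equation. At each `t₀`, diagonalize the transverse Riccati operator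
(`exists_isAdapted`): `Jᵢ' = λᵢ Jᵢ + Kᵢ` with `Kᵢ ∈ Z`. Modulo `Z` the field `Jᵢ` may be replaced by
`Jᵢ - (t - t₀)Kᵢ`, and Hadamard's inequality bounds the squared volume by the product of the squared
norms, up to a constant factor and with equality at `t₀`. The logarithm of the resulting barrier for
`u` has second derivative `-(Σλᵢ² + Σ⟨R Jᵢ, Jᵢ⟩ + 2Σ‖Kᵢ‖²)/m` at `t₀`. The curvature trace is
nonnegative by averaging `Ric_k` over `k`-subsets of the frame, which needs `k ≤ m`; this is the
dimension bound. Cauchy–Schwarz then gives concavity. A positive concave function on the whole line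
is constant (`eq_of_hasConcaveBarrierAt`), so all `λᵢ`, all `Kᵢ(t₀)` and the curvature trace vanish
(`rigidity`).

Part 2 follows because a positive trace contradicts this. For part 1, each class modulo `Z` has at
each `t` a representative `q_t`, horizontal at `t`, with `q_t'(t) = 0`. The field `W(t) = q_t(t)` is
parallel and is annihilated by the curvature operator, so it is a Jacobi field with the initial data
of `q_0`; hence `W = q_0 ∈ Λ` (`JacobiDerivs.exists_parallel`). Orthogonality holds because `⟨J, P⟩`
is constant for parallel `P ∈ Λ` and is zero where `J` vanishes. -/

namespace JacobiSplitting

open Filter Topology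

/-! ### Tangent vectors in chart coordinates. -/

section Charts

lemma symm_mem_source {n : ℕ} {M : Type*} [TopologicalSpace M]
    [ChartedSpace (EuclideanSpace ℝ (Fin n)) M] {x₀ : M} {y : EuclideanSpace ℝ (Fin n)}
    (hy : y ∈ (extChartAt (𝓡 n) x₀).target) :
    (extChartAt (𝓡 n) x₀).symm y ∈ (chartAt (EuclideanSpace ℝ (Fin n)) x₀).source := by
  simpa using (extChartAt (𝓡 n) x₀).map_target hy

lemma extChartAt_mem_target {n : ℕ} {M : Type*} [TopologicalSpace M]
    [ChartedSpace (EuclideanSpace ℝ (Fin n)) M] {x₀ x : M}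
    (hx : x ∈ (chartAt (EuclideanSpace ℝ (Fin n)) x₀).source) :
    extChartAt (𝓡 n) x₀ x ∈ (extChartAt (𝓡 n) x₀).target :=
  (extChartAt (𝓡 n) x₀).map_source (by simpa using hx)

variable {n : ℕ} {M : Type*} [TopologicalSpace M] [ChartedSpace (EuclideanSpace ℝ (Fin n)) M]
  [IsManifold (𝓡 n) ∞ M]

lemma mem_baseSet_trivializationAt {x₀ x : M}
    (hx : x ∈ (chartAt (EuclideanSpace ℝ (Fin n)) x₀).source) :
    x ∈ (trivializationAt (EuclideanSpace ℝ (Fin n))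
      (TangentSpace (𝓡 n) : M → Type _) x₀).baseSet := by
  simpa using hx

lemma ofCoord_coord {x₀ x : M} (hx : x ∈ (chartAt (EuclideanSpace ℝ (Fin n)) x₀).source)
    (u : TangentSpace (𝓡 n) x) : ofCoord x₀ x (coord x₀ x u) = u :=
  Bundle.Trivialization.symmL_continuousLinearMapAt _ (mem_baseSet_trivializationAt hx) u

lemma coord_ofCoord {x₀ x : M} (hx : x ∈ (chartAt (EuclideanSpace ℝ (Fin n)) x₀).source)
    (u : EuclideanSpace ℝ (Fin n)) : coord x₀ x (ofCoord x₀ x u) = u :=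
  Bundle.Trivialization.continuousLinearMapAt_symmL _ (mem_baseSet_trivializationAt hx) u

lemma coord_injective {x₀ x : M} (hx : x ∈ (chartAt (EuclideanSpace ℝ (Fin n)) x₀).source) :
    Function.Injective (coord (n := n) x₀ x) :=
  Function.LeftInverse.injective (ofCoord_coord hx)

lemma ofCoord_injective {x₀ x : M} (hx : x ∈ (chartAt (EuclideanSpace ℝ (Fin n)) x₀).source) :
    Function.Injective (ofCoord (n := n) x₀ x) :=
  Function.LeftInverse.injective (coord_ofCoord hx)

/-- The `i`-th coordinate vector field of the chart around `x₀`. -/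
noncomputable def coordField (x₀ : M) (i : Fin n) (x : M) : TangentSpace (𝓡 n) x :=
  ofCoord x₀ x (EuclideanSpace.single i 1)

lemma ofCoord_eq_sum (x₀ x : M) (a : EuclideanSpace ℝ (Fin n)) :
    ofCoord x₀ x a = ∑ i, a i • coordField x₀ i x := by
  conv_lhs => rw [← (EuclideanSpace.basisFun (Fin n) ℝ).sum_repr a]
  simp [coordField]

lemma eq_sum_coord_smul {x₀ x : M} (hx : x ∈ (chartAt (EuclideanSpace ℝ (Fin n)) x₀).source)
    (u : TangentSpace (𝓡 n) x) : u = ∑ i, coord x₀ x u i • coordField x₀ i x := by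
  rw [← ofCoord_eq_sum, ofCoord_coord hx]

lemma contMDiffOn_coordField (x₀ : M) (i : Fin n) :
    ContMDiffOn (𝓡 n) ((𝓡 n).prod 𝓘(ℝ, EuclideanSpace ℝ (Fin n))) ∞
      (fun x => (⟨x, coordField x₀ i x⟩ : TangentBundle (𝓡 n) M))
      (chartAt (EuclideanSpace ℝ (Fin n)) x₀).source := by
  have h := (trivializationAt (EuclideanSpace ℝ (Fin n))
      (TangentSpace (𝓡 n) : M → Type _) x₀).contMDiffOn_localFrame_baseSet (I := 𝓡 n) ∞
      (EuclideanSpace.basisFun (Fin n) ℝ).toBasis i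
  have hb : (trivializationAt (EuclideanSpace ℝ (Fin n))
      (TangentSpace (𝓡 n) : M → Type _) x₀).baseSet =
      (chartAt (EuclideanSpace ℝ (Fin n)) x₀).source := by simp
  rw [hb] at h
  refine h.congr fun x hx => ?_
  rw [Bundle.Trivialization.localFrame_apply_of_mem_baseSet _ _
    (mem_baseSet_trivializationAt hx)]
  simp only [Bundle.Trivialization.basisAt, Module.Basis.map_apply]
  simp only [coordField, ofCoord, OrthonormalBasis.coe_toBasis, EuclideanSpace.basisFun_apply,
    Bundle.Trivialization.linearEquivAt_symm_apply,
    Bundle.Trivialization.symmL_apply _ (mem_baseSet_trivializationAt hx)]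

lemma hasDerivAt_extChartAt_comp {γ : ℝ → M} {t : ℝ} {x₀ : M}
    (hγ : MDifferentiableAt 𝓘(ℝ, ℝ) (𝓡 n) γ t)
    (ht : γ t ∈ (chartAt (EuclideanSpace ℝ (Fin n)) x₀).source) :
    HasDerivAt (fun s => extChartAt (𝓡 n) x₀ (γ s)) (coord x₀ (γ t) (velocity n γ t)) t := by
  have h1 : MDifferentiableAt (𝓡 n) 𝓘(ℝ, EuclideanSpace ℝ (Fin n)) (extChartAt (𝓡 n) x₀) (γ t) :=
    mdifferentiableAt_extChartAt ht
  let F : ℝ →L[ℝ] EuclideanSpace ℝ (Fin n) :=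
    (mfderiv (𝓡 n) 𝓘(ℝ, EuclideanSpace ℝ (Fin n)) (extChartAt (𝓡 n) x₀) (γ t)).comp
      (mfderiv 𝓘(ℝ, ℝ) (𝓡 n) γ t)
  have h2 : HasFDerivAt (fun s => extChartAt (𝓡 n) x₀ (γ s)) F t :=
    (h1.hasMFDerivAt.comp t hγ.hasMFDerivAt).hasFDerivAt
  unfold coord velocity
  rw [TangentBundle.continuousLinearMapAt_trivializationAt ht]
  exact h2.hasDerivAt

end Charts

/-! ### The metric in coordinates. -/

section Metric

variable {n : ℕ} {M : Type*} [TopologicalSpace M] [ChartedSpace (EuclideanSpace ℝ (Fin n)) M]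
  [IsManifold (𝓡 n) ∞ M] [Bundle.RiemannianBundle (fun x : M => TangentSpace (𝓡 n) x)]

lemma metricMatrix_apply (x₀ : M) (y : EuclideanSpace ℝ (Fin n)) (i j : Fin n) :
    metricMatrix x₀ y i j = inner ℝ (coordField x₀ i ((extChartAt (𝓡 n) x₀).symm y))
      (coordField x₀ j ((extChartAt (𝓡 n) x₀).symm y)) := rfl

lemma metricMatrix_extChartAt {x₀ x : M}
    (hx : x ∈ (chartAt (EuclideanSpace ℝ (Fin n)) x₀).source) (i j : Fin n) :
    metricMatrix x₀ (extChartAt (𝓡 n) x₀ x) i j =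
      inner ℝ (coordField x₀ i x) (coordField x₀ j x) := by
  have h : (extChartAt (𝓡 n) x₀).symm (extChartAt (𝓡 n) x₀ x) = x :=
    (extChartAt (𝓡 n) x₀).left_inv (by simpa using hx)
  rw [metricMatrix_apply, h]

lemma metricMatrix_symm (x₀ : M) (y : EuclideanSpace ℝ (Fin n)) (i j : Fin n) :
    metricMatrix x₀ y i j = metricMatrix x₀ y j i := by
  simp only [metricMatrix_apply, real_inner_comm]

lemma inner_eq_sum_metricMatrix {x₀ x : M}
    (hx : x ∈ (chartAt (EuclideanSpace ℝ (Fin n)) x₀).source) (u v : TangentSpace (𝓡 n) x) :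
    inner ℝ u v = ∑ i, ∑ j, metricMatrix x₀ (extChartAt (𝓡 n) x₀ x) i j
      * coord x₀ x u i * coord x₀ x v j := by
  conv_lhs => rw [eq_sum_coord_smul hx u, eq_sum_coord_smul hx v]
  simp only [sum_inner, inner_sum, real_inner_smul_left, real_inner_smul_right,
    metricMatrix_extChartAt hx]
  rw [Finset.sum_comm]
  refine Finset.sum_congr rfl fun i _ => Finset.sum_congr rfl fun j _ => ?_
  ring

lemma isUnit_det_metricMatrix {x₀ : M} {y : EuclideanSpace ℝ (Fin n)}
    (hy : y ∈ (extChartAt (𝓡 n) x₀).target) : IsUnit (metricMatrix x₀ y).det := by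
  have hli : LinearIndependent ℝ
      (fun i => coordField (n := n) x₀ i ((extChartAt (𝓡 n) x₀).symm y)) := by
    rw [Fintype.linearIndependent_iff]
    intro g hg i
    have h := ofCoord_eq_sum x₀ ((extChartAt (𝓡 n) x₀).symm y) (WithLp.toLp 2 g)
    rw [hg] at h
    have h0 := ofCoord_injective (symm_mem_source hy) (h.trans (map_zero _).symm)
    exact congrArg (fun a : EuclideanSpace ℝ (Fin n) => a i) h0
  have := Matrix.det_gram_ne_zero_iff_linearIndependent (𝕜 := ℝ) |>.2 hli
  exact this.isUnit

variable [IsContMDiffRiemannianBundle (𝓡 n) ∞ (EuclideanSpace ℝ (Fin n))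
      (fun x : M => TangentSpace (𝓡 n) x)]

lemma contDiffOn_metricMatrix (x₀ : M) (i j : Fin n) :
    ContDiffOn ℝ ∞ (fun y => metricMatrix x₀ y i j) (extChartAt (𝓡 n) x₀).target := by
  have h1 : ContMDiffOn (𝓡 n) 𝓘(ℝ, ℝ) ∞
      (fun x : M => inner ℝ (coordField (n := n) x₀ i x) (coordField x₀ j x))
      (chartAt (EuclideanSpace ℝ (Fin n)) x₀).source :=
    (contMDiffOn_coordField x₀ i).inner_bundle (contMDiffOn_coordField x₀ j)
  have h2 := h1.comp (contMDiffOn_extChartAt_symm (n := ∞) (I := 𝓡 n) x₀)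
    fun y hy => symm_mem_source hy
  exact h2.contDiffOn

end Metric

/-! ### Smoothness of matrix inverses and of partial derivatives. -/

section MatrixCalculus

variable {E : Type*} [NormedAddCommGroup E] [NormedSpace ℝ E] {n : ℕ} {s : Set E}
  {A : E → Matrix (Fin n) (Fin n) ℝ}

lemma contDiffOn_det (hA : ∀ i j, ContDiffOn ℝ ∞ (fun y => A y i j) s) :
    ContDiffOn ℝ ∞ (fun y => (A y).det) s := by
  simp only [Matrix.det_apply]
  exact ContDiffOn.sum fun σ _ => (contDiffOn_prod fun i _ => hA _ _).const_smul _

lemma contDiffOn_inv_apply (hA : ∀ i j, ContDiffOn ℝ ∞ (fun y => A y i j) s)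
    (hdet : ∀ y ∈ s, IsUnit (A y).det) (i j : Fin n) :
    ContDiffOn ℝ ∞ (fun y => (A y)⁻¹ i j) s := by
  simp only [Matrix.inv_def, Ring.inverse_eq_inv', Matrix.smul_apply, smul_eq_mul,
    Matrix.adjugate_apply]
  refine ((contDiffOn_det hA).inv fun y hy => (hdet y hy).ne_zero).mul
    (contDiffOn_det fun a b => ?_)
  by_cases h : a = j
  · subst h
    simpa using contDiffOn_const
  · simpa [Matrix.updateRow_ne h] using hA a b

lemma contDiffOn_partialDeriv {f : EuclideanSpace ℝ (Fin n) → ℝ}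
    {s : Set (EuclideanSpace ℝ (Fin n))} (hs : IsOpen s) (hf : ContDiffOn ℝ ∞ f s) (i : Fin n) :
    ContDiffOn ℝ ∞ (partialDeriv i f) s :=
  (hf.fderiv_of_isOpen hs (m := ∞) (by simp)).clm_apply contDiffOn_const

lemma fderiv_eq_sum_partialDeriv (f : EuclideanSpace ℝ (Fin n) → ℝ)
    (y v : EuclideanSpace ℝ (Fin n)) : fderiv ℝ f y v = ∑ i, v i * partialDeriv i f y := by
  conv_lhs => rw [← (EuclideanSpace.basisFun (Fin n) ℝ).sum_repr v]
  simp [partialDeriv]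

end MatrixCalculus

/-! ### Christoffel symbols and metric compatibility. -/

section Connection

variable {n : ℕ} {M : Type*} [TopologicalSpace M] [ChartedSpace (EuclideanSpace ℝ (Fin n)) M]
  [IsManifold (𝓡 n) ∞ M] [Bundle.RiemannianBundle (fun x : M => TangentSpace (𝓡 n) x)]

/-- Lowering the upper index of the Christoffel symbols. -/
lemma sum_metricMatrix_mul_christoffel {x₀ : M} {y : EuclideanSpace ℝ (Fin n)}
    (hy : y ∈ (extChartAt (𝓡 n) x₀).target) (i j l : Fin n) :
    ∑ k, metricMatrix x₀ y l k * christoffel x₀ k i j y =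
      (1 / 2) * (partialDeriv i (fun z => metricMatrix x₀ z j l) y
      + partialDeriv j (fun z => metricMatrix x₀ z i l) y
      - partialDeriv l (fun z => metricMatrix x₀ z i j) y) := by
  have hinv := Matrix.mul_nonsing_inv _ (isUnit_det_metricMatrix hy)
  have happ : ∀ m, ∑ k, metricMatrix x₀ y l k * (metricMatrix x₀ y)⁻¹ k m =
      (1 : Matrix (Fin n) (Fin n) ℝ) l m := fun m => by rw [← hinv, Matrix.mul_apply]
  simp only [christoffel, Finset.mul_sum]
  rw [Finset.sum_comm]
  have : ∀ m, ∑ k, metricMatrix x₀ y l k * (1 / 2 * ((metricMatrix x₀ y)⁻¹ k m *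
      (partialDeriv i (fun z => metricMatrix x₀ z j m) y
      + partialDeriv j (fun z => metricMatrix x₀ z i m) y
      - partialDeriv m (fun z => metricMatrix x₀ z i j) y))) =
      (1 : Matrix (Fin n) (Fin n) ℝ) l m * (1 / 2 *
      (partialDeriv i (fun z => metricMatrix x₀ z j m) y
      + partialDeriv j (fun z => metricMatrix x₀ z i m) y
      - partialDeriv m (fun z => metricMatrix x₀ z i j) y)) := fun m => by
    rw [← happ, Finset.sum_mul]
    exact Finset.sum_congr rfl fun k _ => by ring
  simp only [this, Matrix.one_apply, ite_mul, zero_mul, one_mul, Finset.sum_ite_eq,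
    Finset.mem_univ, if_true]

/-- The Levi-Civita connection is compatible with the metric, in coordinates. -/
lemma partialDeriv_metricMatrix {x₀ : M} {y : EuclideanSpace ℝ (Fin n)}
    (hy : y ∈ (extChartAt (𝓡 n) x₀).target) (l i j : Fin n) :
    partialDeriv l (fun z => metricMatrix x₀ z i j) y =
      ∑ k, metricMatrix x₀ y k j * christoffel x₀ k l i y
      + ∑ k, metricMatrix x₀ y i k * christoffel x₀ k l j y := by
  have h1 := sum_metricMatrix_mul_christoffel hy l i j
  have h2 := sum_metricMatrix_mul_christoffel hy l j i
  have hs : ∀ a b : Fin n, (fun z => metricMatrix x₀ z a b) = fun z => metricMatrix x₀ z b a :=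
    fun a b => funext fun z => metricMatrix_symm x₀ z a b
  simp only [metricMatrix_symm x₀ y _ j]
  rw [h1, h2, hs j i]
  ring

/-- The index bookkeeping of the product rule: `D` stands for the partial derivatives of the metric,
`y` for the velocity, and `A`, `B` for the covariant derivatives of `V`, `W`. The Christoffel terms
cancel after renaming summation indices. -/
lemma sum_metric_compat {n : ℕ} (G : Fin n → Fin n → ℝ) (Γ D : Fin n → Fin n → Fin n → ℝ)
    (hD : ∀ l i j, D l i j = ∑ k, G k j * Γ k l i + ∑ k, G i k * Γ k l j)
    (y V W A B : Fin n → ℝ) :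
    ∑ i, ∑ j, (((∑ l, y l * D l i j) * V i + G i j * (A i - ∑ l, ∑ m, Γ i l m * y l * V m)) * W j
        + G i j * V i * (B j - ∑ l, ∑ m, Γ j l m * y l * W m)) =
      ∑ i, ∑ j, G i j * A i * W j + ∑ i, ∑ j, G i j * V i * B j := by
  have h1 : ∑ i, ∑ j, (∑ l, y l * ∑ k, G k j * Γ k l i) * V i * W j =
      ∑ i, ∑ j, G i j * (∑ l, ∑ m, Γ i l m * y l * V m) * W j := by
    calc ∑ i, ∑ j, (∑ l, y l * ∑ k, G k j * Γ k l i) * V i * W j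
        = ∑ i, ∑ j, ∑ l, ∑ k, G k j * Γ k l i * y l * V i * W j := by
          simp only [Finset.mul_sum, Finset.sum_mul]
          refine Finset.sum_congr rfl fun i _ => Finset.sum_congr rfl fun j _ =>
            Finset.sum_congr rfl fun l _ => Finset.sum_congr rfl fun k _ => by ring
      _ = ∑ j, ∑ k, ∑ l, ∑ i, G k j * Γ k l i * y l * V i * W j := by
          rw [Finset.sum_comm]
          refine Finset.sum_congr rfl fun j _ => ?_
          rw [Finset.sum_comm]
          simp_rw [Finset.sum_comm (s := Finset.univ (α := Fin n)) (t := Finset.univ)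
            (f := fun i k => G k j * Γ k _ i * y _ * V i * W j)]
          rw [Finset.sum_comm]
      _ = _ := by
          rw [Finset.sum_comm]
          simp only [Finset.mul_sum, Finset.sum_mul]
          refine Finset.sum_congr rfl fun i _ => Finset.sum_congr rfl fun j _ =>
            Finset.sum_congr rfl fun l _ => Finset.sum_congr rfl fun k _ => by ring
  have h2 : ∑ i, ∑ j, (∑ l, y l * ∑ k, G i k * Γ k l j) * V i * W j =
      ∑ i, ∑ j, G i j * V i * (∑ l, ∑ m, Γ j l m * y l * W m) := by
    refine Finset.sum_congr rfl fun i _ => ?_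
    calc ∑ j, (∑ l, y l * ∑ k, G i k * Γ k l j) * V i * W j
        = ∑ j, ∑ l, ∑ k, G i k * V i * (Γ k l j * y l * W j) := by
          simp only [Finset.mul_sum, Finset.sum_mul]
          refine Finset.sum_congr rfl fun j _ =>
            Finset.sum_congr rfl fun l _ => Finset.sum_congr rfl fun k _ => by ring
      _ = ∑ k, ∑ l, ∑ j, G i k * V i * (Γ k l j * y l * W j) := by
          rw [Finset.sum_comm]
          simp_rw [Finset.sum_comm (s := Finset.univ (α := Fin n)) (t := Finset.univ)
            (f := fun j k => G i k * V i * (Γ k _ j * y _ * W j))]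
          rw [Finset.sum_comm]
      _ = _ := by simp only [Finset.mul_sum]
  have h3 : ∑ i, ∑ j, (∑ l, y l * D l i j) * V i * W j =
      ∑ i, ∑ j, (∑ l, y l * ∑ k, G k j * Γ k l i) * V i * W j
      + ∑ i, ∑ j, (∑ l, y l * ∑ k, G i k * Γ k l j) * V i * W j := by
    simp only [hD, mul_add, add_mul, Finset.sum_add_distrib]
  have h4 : ∑ i, ∑ j, (((∑ l, y l * D l i j) * V i
        + G i j * (A i - ∑ l, ∑ m, Γ i l m * y l * V m)) * W j
        + G i j * V i * (B j - ∑ l, ∑ m, Γ j l m * y l * W m)) =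
      ∑ i, ∑ j, (∑ l, y l * D l i j) * V i * W j + ∑ i, ∑ j, G i j * A i * W j
      + ∑ i, ∑ j, G i j * V i * B j
      - ∑ i, ∑ j, G i j * (∑ l, ∑ m, Γ i l m * y l * V m) * W j
      - ∑ i, ∑ j, G i j * V i * (∑ l, ∑ m, Γ j l m * y l * W m) := by
    simp only [← Finset.sum_add_distrib, ← Finset.sum_sub_distrib]
    refine Finset.sum_congr rfl fun i _ => Finset.sum_congr rfl fun j _ => by ring
  rw [h4, h3, h1, h2]
  ring

variable [IsContMDiffRiemannianBundle (𝓡 n) ∞ (EuclideanSpace ℝ (Fin n))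
      (fun x : M => TangentSpace (𝓡 n) x)]

lemma contDiffOn_christoffel (x₀ : M) (k i j : Fin n) :
    ContDiffOn ℝ ∞ (christoffel x₀ k i j) (extChartAt (𝓡 n) x₀).target := by
  have ho : IsOpen (extChartAt (𝓡 n) x₀).target := isOpen_extChartAt_target x₀
  have hg := fun a b => contDiffOn_metricMatrix (n := n) x₀ a b
  unfold christoffel
  refine contDiffOn_const.mul (ContDiffOn.sum fun l _ => ?_)
  refine (contDiffOn_inv_apply hg (fun y hy => isUnit_det_metricMatrix hy) k l).mul ?_
  exact ((contDiffOn_partialDeriv ho (hg _ _) _).add (contDiffOn_partialDeriv ho (hg _ _) _)).sub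
    (contDiffOn_partialDeriv ho (hg _ _) _)

lemma contDiffOn_curvatureCoeff (x₀ : M) (l i j k : Fin n) :
    ContDiffOn ℝ ∞ (curvatureCoeff x₀ l i j k) (extChartAt (𝓡 n) x₀).target := by
  have ho : IsOpen (extChartAt (𝓡 n) x₀).target := isOpen_extChartAt_target x₀
  have hc := fun a b c => contDiffOn_christoffel (n := n) x₀ a b c
  unfold curvatureCoeff
  exact ((contDiffOn_partialDeriv ho (hc _ _ _) _).sub
    (contDiffOn_partialDeriv ho (hc _ _ _) _)).add
    (ContDiffOn.sum fun m _ => ((hc _ _ _).mul (hc _ _ _)).sub ((hc _ _ _).mul (hc _ _ _)))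

/-- The product rule for the inner product of two fields along a curve. -/
theorem IsCovDerivAlong.hasDerivAt_inner {γ : ℝ → M}
    (hγ : ContMDiff 𝓘(ℝ, ℝ) (𝓡 n) ∞ γ) {V W A B : ∀ t, TangentSpace (𝓡 n) (γ t)}
    (hV : IsCovDerivAlong γ V A) (hW : IsCovDerivAlong γ W B) (t : ℝ) :
    HasDerivAt (fun s => inner ℝ (V s) (W s)) (inner ℝ (A t) (W t) + inner ℝ (V t) (B t)) t := by
  set x₀ := γ t
  have ht : γ t ∈ (chartAt (EuclideanSpace ℝ (Fin n)) x₀).source :=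
    mem_chart_source (EuclideanSpace ℝ (Fin n)) (γ t)
  have hnear : ∀ᶠ s in nhds t, γ s ∈ (chartAt (EuclideanSpace ℝ (Fin n)) x₀).source :=
    hγ.continuous.continuousAt.eventually_mem
      ((chartAt (EuclideanSpace ℝ (Fin n)) x₀).open_source.mem_nhds ht)
  have hy := extChartAt_mem_target ht
  have hyd := hasDerivAt_extChartAt_comp ((hγ t).mdifferentiableAt (by simp)) ht
  have hg : ∀ i j, HasDerivAt (fun s => metricMatrix x₀ (extChartAt (𝓡 n) x₀ (γ s)) i j)
      (∑ l, coord x₀ (γ t) (velocity n γ t) l *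
        partialDeriv l (fun z => metricMatrix x₀ z i j) (extChartAt (𝓡 n) x₀ (γ t))) t := by
    intro i j
    have hd : DifferentiableAt ℝ (fun z => metricMatrix x₀ z i j) (extChartAt (𝓡 n) x₀ (γ t)) :=
      ((contDiffOn_metricMatrix x₀ i j).contDiffAt
        ((isOpen_extChartAt_target x₀).mem_nhds hy)).differentiableAt (by simp)
    have := hd.hasFDerivAt.comp_hasDerivAt t hyd
    rwa [fderiv_eq_sum_partialDeriv] at this
  have hmain := HasDerivAt.fun_sum (u := Finset.univ) fun i (_ : i ∈ Finset.univ) =>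
    HasDerivAt.fun_sum (u := Finset.univ) fun j (_ : j ∈ Finset.univ) =>
    (((hg i j).mul (hV x₀ t ht i)).mul (hW x₀ t ht j))
  refine (hmain.congr_deriv ?_).congr_of_eventuallyEq ?_
  · rw [inner_eq_sum_metricMatrix ht, inner_eq_sum_metricMatrix ht]
    exact sum_metric_compat _ (fun k l i => christoffel x₀ k l i _) _
      (fun l i j => partialDeriv_metricMatrix hy l i j) _ _ _ _ _
  · filter_upwards [hnear] with s hs
    exact inner_eq_sum_metricMatrix hs _ _

end Connection

/-! ### Linearity and uniqueness of the covariant derivative along a curve. -/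

section CovDeriv

variable {n : ℕ} {M : Type*} [TopologicalSpace M] [ChartedSpace (EuclideanSpace ℝ (Fin n)) M]
  [IsManifold (𝓡 n) ∞ M] [Bundle.RiemannianBundle (fun x : M => TangentSpace (𝓡 n) x)]
  {γ : ℝ → M} {V W A B : ∀ t, TangentSpace (𝓡 n) (γ t)}

lemma IsCovDerivAlong.add (hV : IsCovDerivAlong γ V A) (hW : IsCovDerivAlong γ W B) :
    IsCovDerivAlong γ (V + W) (A + B) := by
  intro x₀ t ht k
  refine (((hV x₀ t ht k).add (hW x₀ t ht k)).congr_deriv ?_).congr_of_eventuallyEq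
    (.of_forall fun s => by simp)
  simp only [Pi.add_apply, map_add, PiLp.add_apply, mul_add, Finset.sum_add_distrib]
  ring

lemma IsCovDerivAlong.smul (c : ℝ) (hV : IsCovDerivAlong γ V A) :
    IsCovDerivAlong γ (c • V) (c • A) := by
  intro x₀ t ht k
  refine (((hV x₀ t ht k).const_mul c).congr_deriv ?_).congr_of_eventuallyEq
    (.of_forall fun s => by simp)
  simp only [Pi.smul_apply, map_smul, PiLp.smul_apply, smul_eq_mul, mul_sub, Finset.mul_sum]
  congr 1
  exact Finset.sum_congr rfl fun i _ => Finset.sum_congr rfl fun j _ => by ring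

lemma IsCovDerivAlong.sub (hV : IsCovDerivAlong γ V A) (hW : IsCovDerivAlong γ W B) :
    IsCovDerivAlong γ (V - W) (A - B) := by
  simpa [sub_eq_add_neg] using hV.add (hW.smul (-1))

lemma IsCovDerivAlong.unique (hA : IsCovDerivAlong γ V A) (hB : IsCovDerivAlong γ V B) :
    A = B := by
  funext t
  have ht := mem_chart_source (EuclideanSpace ℝ (Fin n)) (γ t)
  refine coord_injective ht (PiLp.ext fun k => ?_)
  simpa using (hA (γ t) t ht k).unique (hB (γ t) t ht k)

end CovDeriv

/-! ### Locally uniform comparison of fibre norms with coordinates. -/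

section LocalBounds

variable {n : ℕ} {M : Type*} [TopologicalSpace M] [ChartedSpace (EuclideanSpace ℝ (Fin n)) M]

lemma eventually_mem_chart_source {γ : ℝ → M} {x₀ : M} {t₀ : ℝ} (hγ : ContinuousAt γ t₀)
    (ht : γ t₀ ∈ (chartAt (EuclideanSpace ℝ (Fin n)) x₀).source) :
    ∀ᶠ t in 𝓝 t₀, γ t ∈ (chartAt (EuclideanSpace ℝ (Fin n)) x₀).source :=
  hγ.eventually_mem ((chartAt (EuclideanSpace ℝ (Fin n)) x₀).open_source.mem_nhds ht)

lemma continuousAt_comp_extChartAt {γ : ℝ → M} {x₀ : M} {t₀ : ℝ}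
    {f : EuclideanSpace ℝ (Fin n) → ℝ} (hf : ContDiffOn ℝ ∞ f (extChartAt (𝓡 n) x₀).target)
    (hγ : ContinuousAt γ t₀) (ht : γ t₀ ∈ (chartAt (EuclideanSpace ℝ (Fin n)) x₀).source) :
    ContinuousAt (fun t => f (extChartAt (𝓡 n) x₀ (γ t))) t₀ := by
  have h1 : ContinuousAt f (extChartAt (𝓡 n) x₀ (γ t₀)) :=
    hf.continuousOn.continuousAt
      ((isOpen_extChartAt_target x₀).mem_nhds (extChartAt_mem_target ht))
  have h2 : ContinuousAt (extChartAt (𝓡 n) x₀) (γ t₀) :=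
    continuousAt_extChartAt' (by simpa using ht)
  exact ContinuousAt.comp (f := fun t => extChartAt (𝓡 n) x₀ (γ t)) h1
    (ContinuousAt.comp (g := extChartAt (𝓡 n) x₀) h2 hγ)

variable [IsManifold (𝓡 n) ∞ M] [Bundle.RiemannianBundle (fun x : M => TangentSpace (𝓡 n) x)]

lemma norm_coordField {x₀ x : M} (hx : x ∈ (chartAt (EuclideanSpace ℝ (Fin n)) x₀).source)
    (i : Fin n) :
    ‖coordField x₀ i x‖ = √(metricMatrix x₀ (extChartAt (𝓡 n) x₀ x) i i) := by
  rw [metricMatrix_extChartAt hx, real_inner_self_eq_norm_sq, Real.sqrt_sq (norm_nonneg _)]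

lemma coord_eq_sum_inner {x₀ x : M} (hx : x ∈ (chartAt (EuclideanSpace ℝ (Fin n)) x₀).source)
    (u : TangentSpace (𝓡 n) x) (k : Fin n) :
    coord x₀ x u k = ∑ l, (metricMatrix x₀ (extChartAt (𝓡 n) x₀ x))⁻¹ k l *
      inner ℝ (coordField x₀ l x) u := by
  have hinv := Matrix.nonsing_inv_mul _ (isUnit_det_metricMatrix (extChartAt_mem_target hx))
  have h1 : ∀ l, inner ℝ (coordField x₀ l x) u =
      ∑ j, metricMatrix x₀ (extChartAt (𝓡 n) x₀ x) l j * coord x₀ x u j := by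
    intro l
    conv_lhs => rw [eq_sum_coord_smul hx u]
    simp only [inner_sum, real_inner_smul_right, metricMatrix_extChartAt hx]
    exact Finset.sum_congr rfl fun j _ => mul_comm _ _
  simp only [h1, Finset.mul_sum]
  rw [Finset.sum_comm]
  simp only [← mul_assoc, ← Finset.sum_mul, ← Matrix.mul_apply, hinv]
  simp [Matrix.one_apply]

variable [IsContMDiffRiemannianBundle (𝓡 n) ∞ (EuclideanSpace ℝ (Fin n))
      (fun x : M => TangentSpace (𝓡 n) x)]

/-- The fibre norms vary with `t`, so a constant valid near `t₀` comes from continuity of the metric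
matrix and its inverse along `γ`. It transfers norm estimates to the coordinates in which covariant
derivatives are defined. -/
lemma exists_abs_coord_le {γ : ℝ → M} {x₀ : M} {t₀ : ℝ} (hγ : ContinuousAt γ t₀)
    (ht : γ t₀ ∈ (chartAt (EuclideanSpace ℝ (Fin n)) x₀).source) :
    ∃ C, ∀ᶠ t in 𝓝 t₀, ∀ (u : TangentSpace (𝓡 n) (γ t)) (k : Fin n),
      |coord x₀ (γ t) u k| ≤ C * ‖u‖ := by
  let b : ℝ → ℝ := fun t => ∑ k, ∑ l, |(metricMatrix x₀ (extChartAt (𝓡 n) x₀ (γ t)))⁻¹ k l| *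
    √(metricMatrix x₀ (extChartAt (𝓡 n) x₀ (γ t)) l l)
  have hg := fun a b => contDiffOn_metricMatrix (n := n) x₀ a b
  have hb : ContinuousAt b t₀ := by
    refine tendsto_finsetSum _ fun k _ => tendsto_finsetSum _ fun l _ => ?_
    exact (continuousAt_comp_extChartAt (contDiffOn_inv_apply hg
      (fun y hy => isUnit_det_metricMatrix hy) k l) hγ ht).abs.mul
      (continuousAt_comp_extChartAt (hg l l) hγ ht).sqrt
  refine ⟨b t₀ + 1, ?_⟩
  filter_upwards [hb.eventually_lt continuousAt_const (lt_add_one (b t₀)),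
    eventually_mem_chart_source hγ ht] with t hbt hs u k
  calc |coord x₀ (γ t) u k|
      ≤ ∑ l, |(metricMatrix x₀ (extChartAt (𝓡 n) x₀ (γ t)))⁻¹ k l *
        inner ℝ (coordField x₀ l (γ t)) u| := by
        rw [coord_eq_sum_inner hs]
        exact Finset.abs_sum_le_sum_abs _ _
    _ ≤ ∑ l, (|(metricMatrix x₀ (extChartAt (𝓡 n) x₀ (γ t)))⁻¹ k l| *
        √(metricMatrix x₀ (extChartAt (𝓡 n) x₀ (γ t)) l l)) * ‖u‖ := by
        refine Finset.sum_le_sum fun l _ => ?_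
        rw [abs_mul, mul_assoc, ← norm_coordField hs]
        exact mul_le_mul_of_nonneg_left (abs_real_inner_le_norm _ _) (abs_nonneg _)
    _ ≤ b t * ‖u‖ := by
        rw [← Finset.sum_mul]
        refine mul_le_mul_of_nonneg_right ?_ (norm_nonneg _)
        exact Finset.single_le_sum (f := fun k => ∑ l,
          |(metricMatrix x₀ (extChartAt (𝓡 n) x₀ (γ t)))⁻¹ k l| *
          √(metricMatrix x₀ (extChartAt (𝓡 n) x₀ (γ t)) l l))
          (fun k _ => Finset.sum_nonneg fun l _ => by positivity) (Finset.mem_univ k)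
    _ ≤ (b t₀ + 1) * ‖u‖ := mul_le_mul_of_nonneg_right hbt.le (norm_nonneg _)

lemma exists_norm_ofCoord_le {γ : ℝ → M} {x₀ : M} {t₀ : ℝ} (hγ : ContinuousAt γ t₀)
    (ht : γ t₀ ∈ (chartAt (EuclideanSpace ℝ (Fin n)) x₀).source) :
    ∃ C, 0 ≤ C ∧ ∀ᶠ t in 𝓝 t₀, ∀ a : EuclideanSpace ℝ (Fin n),
      ‖ofCoord x₀ (γ t) a‖ ≤ C * ∑ l, |a l| := by
  let b : ℝ → ℝ := fun t => ∑ l, √(metricMatrix x₀ (extChartAt (𝓡 n) x₀ (γ t)) l l)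
  have hb : ContinuousAt b t₀ := tendsto_finsetSum _ fun l _ =>
    (continuousAt_comp_extChartAt (contDiffOn_metricMatrix x₀ l l) hγ ht).sqrt
  have hb0 : ∀ t, 0 ≤ b t := fun t => Finset.sum_nonneg fun l _ => Real.sqrt_nonneg _
  refine ⟨b t₀ + 1, by linarith [hb0 t₀], ?_⟩
  filter_upwards [hb.eventually_lt continuousAt_const (lt_add_one (b t₀)),
    eventually_mem_chart_source hγ ht] with t hbt hs a
  rw [ofCoord_eq_sum, Finset.mul_sum]
  refine (norm_sum_le _ _).trans (Finset.sum_le_sum fun l _ => ?_)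
  rw [norm_smul, mul_comm, Real.norm_eq_abs, norm_coordField hs]
  refine mul_le_mul_of_nonneg_right (le_trans ?_ hbt.le) (abs_nonneg _)
  exact Finset.single_le_sum
    (f := fun l => √(metricMatrix x₀ (extChartAt (𝓡 n) x₀ (γ t)) l l))
    (fun l _ => Real.sqrt_nonneg _) (Finset.mem_univ l)

/-- A field along `γ` which agrees to first order at every time with a field whose covariant
derivative vanishes at that time is parallel. -/
lemma isCovDerivAlong_zero_of_isLittleO {γ : ℝ → M} (hγ : Continuous γ)
    {W : ∀ t, TangentSpace (𝓡 n) (γ t)}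
    (h : ∀ t₀, ∃ q q' : ∀ t, TangentSpace (𝓡 n) (γ t), IsCovDerivAlong γ q q' ∧ q' t₀ = 0 ∧
      W t₀ = q t₀ ∧ (fun t => ‖W t - q t‖) =o[𝓝 t₀] fun t => t - t₀) :
    IsCovDerivAlong γ W 0 := by
  intro x₀ t ht k
  obtain ⟨q, q', hq, hq0, hWq, ho⟩ := h t
  obtain ⟨C, hC⟩ := exists_abs_coord_le hγ.continuousAt ht
  have h1 : HasDerivAt (fun s => coord x₀ (γ s) (W s - q s) k) 0 t := by
    rw [hasDerivAt_iff_isLittleO]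
    have hO : (fun s => coord x₀ (γ s) (W s - q s) k) =O[𝓝 t] fun s => ‖W s - q s‖ := by
      refine Asymptotics.IsBigO.of_bound C ?_
      filter_upwards [hC] with s hs
      simpa using hs (W s - q s) k
    simpa [hWq] using hO.trans_isLittleO ho
  refine ((h1.add (hq x₀ t ht k)).congr_deriv ?_).congr_of_eventuallyEq
    (.of_forall fun s => by simp)
  rw [hq0, hWq]
  simp

end LocalBounds

/-! ### The curvature operator along the geodesic. -/

section Curvature

variable {n : ℕ} {M : Type*} [TopologicalSpace M] [ChartedSpace (EuclideanSpace ℝ (Fin n)) M]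
  [IsManifold (𝓡 n) ∞ M] [Bundle.RiemannianBundle (fun x : M => TangentSpace (𝓡 n) x)]

/-- The matrix of the operator `R(·, v)v` in the chart around `x₀`. -/
noncomputable def curvatureMatrix (x₀ x : M) (v : TangentSpace (𝓡 n) x) (l i : Fin n) : ℝ :=
  ∑ j, ∑ k, curvatureCoeff x₀ l i j k (extChartAt (𝓡 n) x₀ x) * coord x₀ x v j * coord x₀ x v k

lemma curvature_eq_ofCoord (x₀ x : M) (u v : TangentSpace (𝓡 n) x) :
    curvature x₀ x u v v = ofCoord x₀ x (WithLp.toLp 2 fun l =>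
      ∑ i, curvatureMatrix x₀ x v l i * coord x₀ x u i) := by
  unfold curvature curvatureMatrix
  congr 2
  funext l
  simp only [Finset.sum_mul]
  exact Finset.sum_congr rfl fun i _ => Finset.sum_congr rfl fun j _ =>
    Finset.sum_congr rfl fun k _ => by ring

lemma curvature_sub (x₀ x : M) (u u' v : TangentSpace (𝓡 n) x) :
    curvature x₀ x (u - u') v v = curvature x₀ x u v v - curvature x₀ x u' v v := by
  simp only [curvature_eq_ofCoord, ← map_sub]
  congr 1
  refine PiLp.ext fun l => ?_
  simp [mul_sub]

variable [IsContMDiffRiemannianBundle (𝓡 n) ∞ (EuclideanSpace ℝ (Fin n))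
      (fun x : M => TangentSpace (𝓡 n) x)]

lemma continuousAt_curvatureMatrix {γ : ℝ → M} {x₀ : M} {t₀ : ℝ}
    (hγ : IsUnitSpeedGeodesic n γ)
    (ht : γ t₀ ∈ (chartAt (EuclideanSpace ℝ (Fin n)) x₀).source) (l i : Fin n) :
    ContinuousAt (fun t => curvatureMatrix x₀ (γ t) (velocity n γ t) l i) t₀ := by
  have hv := fun j => (hγ.2.1 x₀ t₀ ht j).continuousAt
  refine tendsto_finsetSum _ fun j _ => tendsto_finsetSum _ fun k _ => ?_
  exact ((continuousAt_comp_extChartAt (contDiffOn_curvatureCoeff x₀ l i j k)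
    hγ.1.continuous.continuousAt ht).mul (hv j)).mul (hv k)

lemma exists_norm_curvature_le {γ : ℝ → M} {x₀ : M} {t₀ : ℝ} (hγ : IsUnitSpeedGeodesic n γ)
    (ht : γ t₀ ∈ (chartAt (EuclideanSpace ℝ (Fin n)) x₀).source) :
    ∃ C, ∀ᶠ t in 𝓝 t₀, ∀ u : TangentSpace (𝓡 n) (γ t),
      ‖curvature x₀ (γ t) u (velocity n γ t) (velocity n γ t)‖ ≤ C * ‖u‖ := by
  obtain ⟨C₁, hC₁⟩ := exists_abs_coord_le hγ.1.continuous.continuousAt ht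
  obtain ⟨C₂, hC₂0, hC₂⟩ := exists_norm_ofCoord_le hγ.1.continuous.continuousAt ht
  let b : ℝ → ℝ := fun t => ∑ l, ∑ i, |curvatureMatrix x₀ (γ t) (velocity n γ t) l i|
  have hb : ContinuousAt b t₀ := tendsto_finsetSum _ fun l _ => tendsto_finsetSum _ fun i _ =>
    (continuousAt_curvatureMatrix hγ ht l i).abs
  refine ⟨C₂ * ((b t₀ + 1) * |C₁|), ?_⟩
  filter_upwards [hC₁, hC₂, hb.eventually_lt continuousAt_const (lt_add_one (b t₀))]
    with t h₁ h₂ hbt u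
  rw [curvature_eq_ofCoord, mul_assoc]
  refine (h₂ _).trans (mul_le_mul_of_nonneg_left ?_ hC₂0)
  calc ∑ l, |∑ i, curvatureMatrix x₀ (γ t) (velocity n γ t) l i * coord x₀ (γ t) u i|
      ≤ ∑ l, ∑ i, |curvatureMatrix x₀ (γ t) (velocity n γ t) l i| * (|C₁| * ‖u‖) := by
        refine Finset.sum_le_sum fun l _ => (Finset.abs_sum_le_sum_abs _ _).trans
          (Finset.sum_le_sum fun i _ => ?_)
        rw [abs_mul]
        exact mul_le_mul_of_nonneg_left ((h₁ u i).trans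
          (mul_le_mul_of_nonneg_right (le_abs_self _) (norm_nonneg _))) (abs_nonneg _)
    _ = b t * (|C₁| * ‖u‖) := by simp only [b, Finset.sum_mul]
    _ ≤ (b t₀ + 1) * |C₁| * ‖u‖ := by
        rw [mul_assoc]
        exact mul_le_mul_of_nonneg_right hbt.le (by positivity)

lemma curvature_eq_zero_of_eventually {γ : ℝ → M} {x₀ : M} {t₀ : ℝ}
    (hγ : IsUnitSpeedGeodesic n γ)
    (ht : γ t₀ ∈ (chartAt (EuclideanSpace ℝ (Fin n)) x₀).source)
    {V V' : ∀ t, TangentSpace (𝓡 n) (γ t)} (hV : IsCovDerivAlong γ V V')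
    (h : ∀ᶠ t in 𝓝[≠] t₀, curvature x₀ (γ t) (V t) (velocity n γ t) (velocity n γ t) = 0) :
    curvature x₀ (γ t₀) (V t₀) (velocity n γ t₀) (velocity n γ t₀) = 0 := by
  rw [curvature_eq_ofCoord]
  refine (congrArg _ (PiLp.ext fun l => ?_)).trans (map_zero (ofCoord x₀ (γ t₀)))
  have hc : ContinuousAt (fun t => ∑ i, curvatureMatrix x₀ (γ t) (velocity n γ t) l i *
      coord x₀ (γ t) (V t) i) t₀ := tendsto_finsetSum _ fun i _ =>
    (continuousAt_curvatureMatrix hγ ht l i).mul (hV x₀ t₀ ht i).continuousAt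
  refine tendsto_nhds_unique (l := 𝓝[≠] t₀) (hc.tendsto.mono_left nhdsWithin_le_nhds)
    (tendsto_const_nhds.congr' ?_)
  filter_upwards [h, nhdsWithin_le_nhds
    (eventually_mem_chart_source hγ.1.continuous.continuousAt ht)] with t h0 hs
  rw [curvature_eq_ofCoord] at h0
  have := ofCoord_injective hs (h0.trans (map_zero _).symm)
  exact (congrArg (fun a : EuclideanSpace ℝ (Fin n) => a l) this).symm

end Curvature

/-! ### Grönwall's inequality and uniqueness for second order equations. -/

section Uniqueness

/-- A nonnegative differentiable function with `|f'| ≤ C f` locally which vanishes somewhere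
vanishes identically. -/
lemma eq_zero_of_locally_abs_deriv_le {f f' : ℝ → ℝ} (hf0 : ∀ t, 0 ≤ f t)
    (hf : ∀ t, HasDerivAt f (f' t) t)
    (hbound : ∀ t₀, ∃ C, ∀ᶠ t in 𝓝 t₀, |f' t| ≤ C * f t) {t₀ : ℝ} (h0 : f t₀ = 0) (t : ℝ) :
    f t = 0 := by
  have hcont : Continuous f := continuous_iff_continuousAt.2 fun t => (hf t).continuousAt
  have hclosed : IsClosed {t | f t = 0} := isClosed_eq hcont continuous_const
  have hopen : IsOpen {t | f t = 0} := by
    rw [isOpen_iff_mem_nhds]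
    intro a ha
    obtain ⟨C, hC⟩ := hbound a
    obtain ⟨ε, hε, hball⟩ := Metric.eventually_nhds_iff_ball.1 hC
    refine Filter.mem_of_superset (Metric.ball_mem_nhds a hε) fun b hb => ?_
    -- Grönwall's integrating factor, used with `c = -C` to the right of `a` and with `c = C` to the
    -- left.
    have hgr : ∀ c : ℝ, ∀ t, HasDerivAt (fun t => f t * Real.exp (c * t))
        (f' t * Real.exp (c * t) + f t * (Real.exp (c * t) * c)) t := fun c t =>
      (hf t).mul (by simpa using ((hasDerivAt_id t).const_mul c).exp)
    have hsub : ∀ t ∈ Set.uIcc a b, t ∈ Metric.ball a ε := fun t ht =>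
      (convex_ball a ε).ordConnected.uIcc_subset (Metric.mem_ball_self hε) hb ht
    have hle : f b ≤ 0 := by
      rcases le_total a b with hab | hab
      · have hanti : AntitoneOn (fun t => f t * Real.exp (-C * t)) (Set.Icc a b) := by
          refine antitoneOn_of_hasDerivWithinAt_nonpos (convex_Icc a b)
            (fun t _ => (hgr _ t).continuousAt.continuousWithinAt)
            (fun t _ => (hgr _ t).hasDerivWithinAt) fun t ht => ?_
          have hb' := hball t (hsub t (by
            rw [Set.uIcc_of_le hab]; exact interior_subset ht))
          have : f' t ≤ C * f t := (le_abs_self _).trans hb'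
          nlinarith [Real.exp_pos (-C * t)]
        have := hanti (Set.left_mem_Icc.2 hab) (Set.right_mem_Icc.2 hab) hab
        simp only [show f a = 0 from ha, zero_mul] at this
        nlinarith [Real.exp_pos (-C * b)]
      · have hmono : MonotoneOn (fun t => f t * Real.exp (C * t)) (Set.Icc b a) := by
          refine monotoneOn_of_hasDerivWithinAt_nonneg (convex_Icc b a)
            (fun t _ => (hgr _ t).continuousAt.continuousWithinAt)
            (fun t _ => (hgr _ t).hasDerivWithinAt) fun t ht => ?_
          have hb' := hball t (hsub t (by
            rw [Set.uIcc_of_ge hab]; exact interior_subset ht))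
          have : -f' t ≤ C * f t := (neg_le_abs _).trans hb'
          nlinarith [Real.exp_pos (C * t)]
        have := hmono (Set.left_mem_Icc.2 hab) (Set.right_mem_Icc.2 hab) hab
        simp only [show f a = 0 from ha, zero_mul] at this
        nlinarith [Real.exp_pos (C * b)]
    exact le_antisymm hle (hf0 b)
  have huniv := IsClopen.eq_univ ⟨hclosed, hopen⟩ ⟨t₀, h0⟩
  exact (huniv ▸ Set.mem_univ t : t ∈ {t | f t = 0})

variable {n : ℕ} {M : Type*} [TopologicalSpace M] [ChartedSpace (EuclideanSpace ℝ (Fin n)) M]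
  [IsManifold (𝓡 n) ∞ M] [Bundle.RiemannianBundle (fun x : M => TangentSpace (𝓡 n) x)]
  [IsContMDiffRiemannianBundle (𝓡 n) ∞ (EuclideanSpace ℝ (Fin n))
      (fun x : M => TangentSpace (𝓡 n) x)]

/-- Uniqueness for second order linear equations along a curve. -/
lemma eq_zero_of_secondOrder {γ : ℝ → M} (hγ : ContMDiff 𝓘(ℝ, ℝ) (𝓡 n) ∞ γ)
    {V W A : ∀ t, TangentSpace (𝓡 n) (γ t)} (hV : IsCovDerivAlong γ V W)
    (hW : IsCovDerivAlong γ W A) (hbound : ∀ t₀, ∃ C, ∀ᶠ t in 𝓝 t₀, ‖A t‖ ≤ C * ‖V t‖)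
    {t₀ : ℝ} (hV0 : V t₀ = 0) (hW0 : W t₀ = 0) : V = 0 := by
  -- The energy `‖V‖² + ‖W‖²` has derivative bounded by `1 + |C|` times itself.
  have hd : ∀ t, HasDerivAt (fun s => inner ℝ (V s) (V s) + inner ℝ (W s) (W s))
      (inner ℝ (W t) (V t) + inner ℝ (V t) (W t) + (inner ℝ (A t) (W t) + inner ℝ (W t) (A t))) t :=
    fun t => (hV.hasDerivAt_inner hγ hV t).add (hW.hasDerivAt_inner hγ hW t)
  have hz := eq_zero_of_locally_abs_deriv_le
    (fun t => add_nonneg real_inner_self_nonneg real_inner_self_nonneg) hd ?_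
    (t₀ := t₀) (by simp [hV0, hW0])
  · funext t
    have h1 := hz t
    have h2 : (0 : ℝ) ≤ inner ℝ (V t) (V t) := real_inner_self_nonneg
    have h3 : (0 : ℝ) ≤ inner ℝ (W t) (W t) := real_inner_self_nonneg
    exact inner_self_eq_zero.1 (le_antisymm (by linarith) h2)
  · intro a
    obtain ⟨C, hC⟩ := hbound a
    refine ⟨1 + |C|, ?_⟩
    filter_upwards [hC] with t ht
    rw [real_inner_comm (V t) (W t), real_inner_comm (A t) (W t),
      real_inner_self_eq_norm_sq, real_inner_self_eq_norm_sq]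
    have h1 := abs_real_inner_le_norm (V t) (W t)
    have h2 := abs_real_inner_le_norm (A t) (W t)
    have h3 : ‖A t‖ * ‖W t‖ ≤ |C| * ‖V t‖ * ‖W t‖ := mul_le_mul_of_nonneg_right
      (ht.trans (mul_le_mul_of_nonneg_right (le_abs_self C) (norm_nonneg _))) (norm_nonneg _)
    have h4 := two_mul_le_add_sq ‖V t‖ ‖W t‖
    have h5 : |C| * (2 * ‖V t‖ * ‖W t‖) ≤ |C| * (‖V t‖ ^ 2 + ‖W t‖ ^ 2) :=
      mul_le_mul_of_nonneg_left h4 (abs_nonneg C)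
    rw [abs_le] at h1 h2 ⊢
    constructor <;> nlinarith

end Uniqueness

/-! ### Concavity in the barrier sense on the line. -/

section Scalar

/-- Second order Taylor expansion by l'Hôpital, with `f'` assumed differentiable only at `t₀`. -/
lemma tendsto_div_sq_of_hasDerivAt {f f' : ℝ → ℝ} {t₀ d : ℝ}
    (hf : ∀ᶠ t in 𝓝 t₀, HasDerivAt f (f' t) t) (hf' : HasDerivAt f' d t₀)
    (h0 : f t₀ = 0) (h0' : f' t₀ = 0) :
    Tendsto (fun t => f t / (t - t₀) ^ 2) (𝓝[≠] t₀) (𝓝 (d / 2)) := by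
  have hg : ∀ t : ℝ, HasDerivAt (fun t => (t - t₀) ^ 2) (2 * (t - t₀)) t := fun t => by
    simpa using ((hasDerivAt_id t).sub_const t₀).fun_pow 2
  refine HasDerivAt.lhopital_zero_nhdsNE (nhdsWithin_le_nhds hf) (.of_forall hg) ?_ ?_ ?_ ?_
  · filter_upwards [self_mem_nhdsWithin] with t ht
    simpa [sub_eq_zero] using ht
  · simpa [h0] using hf.self_of_nhds.continuousAt.tendsto.mono_left
      (nhdsWithin_le_nhds (s := {t₀}ᶜ))
  · simpa using (hg t₀).continuousAt.tendsto.mono_left (nhdsWithin_le_nhds (s := {t₀}ᶜ))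
  · have h := (hasDerivAt_iff_tendsto_slope.1 hf').div_const 2
    refine h.congr fun t => ?_
    rw [slope_def_field, h0', sub_zero, div_div, mul_comm]

lemma nonneg_of_isLocalMin {f f' : ℝ → ℝ} {t₀ d : ℝ}
    (hf : ∀ᶠ t in 𝓝 t₀, HasDerivAt f (f' t) t) (hf' : HasDerivAt f' d t₀)
    (hmin : IsLocalMin f t₀) : f' t₀ = 0 ∧ 0 ≤ d := by
  have h0 : f' t₀ = 0 := hmin.hasDerivAt_eq_zero hf.self_of_nhds
  refine ⟨h0, ?_⟩
  have h := tendsto_div_sq_of_hasDerivAt (f := fun t => f t - f t₀)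
    (hf.mono fun t ht => ht.sub_const _) hf' (sub_self _) h0
  have : 0 ≤ d / 2 := by
    refine ge_of_tendsto h (nhdsWithin_le_nhds ?_)
    filter_upwards [hmin] with t ht
    exact div_nonneg (sub_nonneg.2 ht) (sq_nonneg _)
  linarith

/-- `u` admits at `t₀` an upper barrier `u(t₀) exp ℓ` with nonpositive second derivative. -/
def HasConcaveBarrierAt (u : ℝ → ℝ) (t₀ : ℝ) : Prop :=
  ∃ (l l' : ℝ → ℝ) (d : ℝ), (∀ᶠ t in 𝓝 t₀, HasDerivAt l (l' t) t) ∧ HasDerivAt l' d t₀ ∧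
    l t₀ = 0 ∧ d + l' t₀ ^ 2 ≤ 0 ∧ ∀ᶠ t in 𝓝 t₀, u t ≤ u t₀ * Real.exp (l t)

/-- At a negative minimum `m` of `w = u + ε(t - a)(b - t) - chord`, necessarily interior, replacing
`u` by its barrier gives a function that also has a local minimum at `m`. Its second derivative
there is at most `-2ε`, which is impossible. The `ε` term supplies the strictness. -/
lemma chord_le_of_hasConcaveBarrierAt {u : ℝ → ℝ} (hu : Continuous u) (hpos : ∀ t, 0 < u t)
    (hbar : ∀ t, HasConcaveBarrierAt u t) {a b : ℝ} (hab : a < b) {ε : ℝ} (hε : 0 < ε)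
    {c : ℝ} (hc : c ∈ Set.Icc a b) :
    (u a * (b - c) + u b * (c - a)) / (b - a) ≤ u c + ε * ((c - a) * (b - c)) := by
  let w : ℝ → ℝ := fun t => u t + ε * ((t - a) * (b - t))
    - (u a * (b - t) + u b * (t - a)) / (b - a)
  have hba : b - a ≠ 0 := (sub_pos.2 hab).ne'
  have hwc : Continuous w := by fun_prop
  obtain ⟨m, hm, hmin⟩ := isCompact_Icc.exists_isMinOn ⟨c, hc⟩ hwc.continuousOn
  suffices h : 0 ≤ w m by
    have := hmin hc
    simp only [Set.mem_ofPred_eq] at this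
    have h2 : 0 ≤ w c := h.trans this
    simp only [w] at h2
    linarith
  by_contra! hneg
  have hwa : w a = 0 := by simp only [w]; field_simp; ring
  have hwb : w b = 0 := by simp only [w]; field_simp; ring
  have hma : a < m := lt_of_le_of_ne hm.1 fun h => by rw [← h, hwa] at hneg; exact hneg.false
  have hmb : m < b := lt_of_le_of_ne hm.2 fun h => by rw [h, hwb] at hneg; exact hneg.false
  obtain ⟨l, l', d, hl, hl', hl0, hd, hle⟩ := hbar m
  let f : ℝ → ℝ := fun t => u m * Real.exp (l t) + ε * ((t - a) * (b - t))
    - (u a * (b - t) + u b * (t - a)) / (b - a)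
  let f' : ℝ → ℝ := fun t => u m * (Real.exp (l t) * l' t) + ε * (b - t - (t - a))
    - (u b - u a) / (b - a)
  have hf : ∀ᶠ t in 𝓝 m, HasDerivAt f (f' t) t := by
    filter_upwards [hl] with t ht
    have h1 : HasDerivAt (fun t => (t - a) * (b - t)) (b - t - (t - a)) t := by
      refine (((hasDerivAt_id t).sub_const a).mul ((hasDerivAt_id t).const_sub b)).congr_deriv ?_
      simp
      ring
    have h2 : HasDerivAt (fun t => u a * (b - t) + u b * (t - a)) (u b - u a) t := by
      refine ((((hasDerivAt_id t).const_sub b).const_mul (u a)).add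
        (((hasDerivAt_id t).sub_const a).const_mul (u b))).congr_deriv ?_
      ring
    exact ((ht.exp.const_mul (u m)).add (h1.const_mul ε)).sub (h2.div_const (b - a))
  have hf' : HasDerivAt f' (u m * (d + l' m ^ 2) - 2 * ε) m := by
    have h1 : HasDerivAt (fun t => b - t - (t - a)) (-2) m := by
      refine (((hasDerivAt_id m).const_sub b).sub ((hasDerivAt_id m).sub_const a)).congr_deriv ?_
      norm_num
    refine ((((hl.self_of_nhds.exp.mul hl').const_mul (u m)).add
      (h1.const_mul ε)).sub_const ((u b - u a) / (b - a))).congr_deriv ?_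
    simp only [hl0, Real.exp_zero]
    ring
  have hfmin : IsLocalMin f m := by
    filter_upwards [hle, Icc_mem_nhds hma hmb] with t ht htI
    have h1 : w m ≤ w t := hmin htI
    have h2 : f m = w m := by simp [f, w, hl0]
    have h3 : w t ≤ f t := by simp only [w, f]; linarith
    linarith
  have := (nonneg_of_isLocalMin hf hf' hfmin).2
  nlinarith [mul_nonneg (hpos m).le (neg_nonneg.2 hd)]

/-- A positive function on the line which is concave in the barrier sense is constant. -/
lemma eq_of_hasConcaveBarrierAt {u : ℝ → ℝ} (hu : Continuous u) (hpos : ∀ t, 0 < u t)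
    (hbar : ∀ t, HasConcaveBarrierAt u t) (s t : ℝ) : u s = u t := by
  have hchord : ∀ a c b, a < c → c < b → u a * (b - c) + u b * (c - a) ≤ u c * (b - a) := by
    intro a c b hac hcb
    have hab := hac.trans hcb
    have h : (u a * (b - c) + u b * (c - a)) / (b - a) ≤ u c := by
      refine le_of_forall_pos_le_add fun δ hδ => ?_
      have hp : 0 < (c - a) * (b - c) := mul_pos (sub_pos.2 hac) (sub_pos.2 hcb)
      have := chord_le_of_hasConcaveBarrierAt hu hpos hbar hab (div_pos hδ hp) ⟨hac.le, hcb.le⟩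
      rwa [div_mul_cancel₀ _ hp.ne'] at this
    rwa [div_le_iff₀ (sub_pos.2 hab)] at h
  have key : ∀ a c, a < c → u a = u c := by
    intro a c hac
    refine le_antisymm ?_ ?_
    · by_contra! hlt
      have hda := sub_pos.2 hlt
      -- Chosen so far to the right that the chord inequality on `a < c < b` would give `u b * (c -
      -- a) ≤ -1`.
      set b := c + (u c * (c - a) + 1) / (u a - u c) with hb
      have hq : 0 < (u c * (c - a) + 1) / (u a - u c) :=
        div_pos (by nlinarith [hpos c]) hda
      have h := hchord a c b hac (by linarith)
      have h2 : (u a - u c) * (b - c) = u c * (c - a) + 1 := by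
        rw [hb]; field_simp; ring
      nlinarith [mul_pos (hpos b) (sub_pos.2 hac)]
    · by_contra! hlt
      have hda := sub_pos.2 hlt
      set b := a - (u a * (c - a) + 1) / (u c - u a) with hb
      have hq : 0 < (u a * (c - a) + 1) / (u c - u a) :=
        div_pos (by nlinarith [hpos a]) hda
      have h := hchord b a c (by linarith) hac
      have h2 : (u c - u a) * (a - b) = u a * (c - a) + 1 := by
        rw [hb]; field_simp; ring
      nlinarith [mul_pos (hpos b) (sub_pos.2 hac)]
  rcases lt_trichotomy s t with h | h | h
  · exact key s t h
  · rw [h]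
  · exact (key t s h).symm

end Scalar

/-! ### Averaging over `k`-element subfamilies. -/

section Average

/-- Take the `m` cyclic translates of the first `k` indices; addition in `Fin m` is modular, so
every index is covered exactly `k` times. Bounds on sums of `k` curvatures thereby pass to the full
trace. -/
lemma exists_cyclic_sum {k m : ℕ} (hk : 1 ≤ k) (hkm : k ≤ m) (a : Fin m → ℝ) :
    ∃ f : Fin m → Fin k → Fin m, (∀ s, Function.Injective (f s)) ∧
      ∑ s, ∑ i, a (f s i) = k * ∑ j, a j := by
  have : NeZero m := ⟨by omega⟩
  refine ⟨fun s i => Fin.castLE hkm i + s, fun s => ?_, ?_⟩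
  · intro i j hij
    exact Fin.castLE_injective hkm (add_right_cancel hij)
  · rw [Finset.sum_comm]
    have : ∀ i : Fin k, ∑ s, a (Fin.castLE hkm i + s) = ∑ j, a j := fun i =>
      Equiv.sum_comp (Equiv.addLeft (Fin.castLE hkm i)) a
    simp [this]

lemma sum_nonneg_of_injective {k m : ℕ} (hk : 1 ≤ k) (hkm : k ≤ m) {a : Fin m → ℝ}
    (h : ∀ f : Fin k → Fin m, Function.Injective f → 0 ≤ ∑ i, a (f i)) : 0 ≤ ∑ j, a j := by
  obtain ⟨f, hf, hsum⟩ := exists_cyclic_sum hk hkm a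
  have h1 : 0 ≤ (k : ℝ) * ∑ j, a j := hsum ▸ Finset.sum_nonneg fun s _ => h _ (hf s)
  exact nonneg_of_mul_nonneg_right h1 (by exact_mod_cast hk)

lemma sum_pos_of_injective {k m : ℕ} (hk : 1 ≤ k) (hkm : k ≤ m) {a : Fin m → ℝ}
    (h : ∀ f : Fin k → Fin m, Function.Injective f → 0 < ∑ i, a (f i)) : 0 < ∑ j, a j := by
  have : NeZero m := ⟨by omega⟩
  obtain ⟨f, hf, hsum⟩ := exists_cyclic_sum hk hkm a
  have h1 : 0 < (k : ℝ) * ∑ j, a j :=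
    hsum ▸ Finset.sum_pos (fun s _ => h _ (hf s)) Finset.univ_nonempty
  exact pos_of_mul_pos_right h1 (by positivity)

end Average

/-! ### Hadamard's inequality. -/

section Hadamard

/-- Hadamard's inequality for Gram determinants. -/
lemma det_gram_le_prod_norm_sq {E : Type*} [NormedAddCommGroup E] [InnerProductSpace ℝ E]
    {m : ℕ} (v : Fin m → E) : (Matrix.gram ℝ v).det ≤ ∏ i, ‖v i‖ ^ 2 := by
  by_cases hv : LinearIndependent ℝ v
  · let S := Submodule.span ℝ (Set.range v)
    have : FiniteDimensional ℝ S := FiniteDimensional.span_of_finite ℝ (Set.finite_range v)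
    have hS : Module.finrank ℝ S = m := by
      simpa using finrank_span_eq_card hv
    let b : OrthonormalBasis (Fin m) ℝ S := (stdOrthonormalBasis ℝ S).reindex (finCongr hS)
    let w : Fin m → S := fun i => ⟨v i, Submodule.subset_span ⟨i, rfl⟩⟩
    have hgram : Matrix.gram ℝ v = Matrix.gram ℝ w := by ext i j; rfl
    have : Fact (Module.finrank ℝ S = m) := ⟨hS⟩
    rw [hgram, Matrix.gram_eq_conjTranspose_mul b w, Matrix.det_mul, Matrix.det_conjTranspose]
    have h1 := b.toBasis.orientation.abs_volumeForm_apply_le w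
    rw [b.toBasis.orientation.volumeForm_robust' b w, Module.Basis.det_apply] at h1
    have h2 : ∏ i, ‖v i‖ ^ 2 = (∏ i, ‖w i‖) ^ 2 := by
      rw [← Finset.prod_pow]; rfl
    rw [h2, star_trivial, ← sq, ← sq_abs]
    exact pow_le_pow_left₀ (abs_nonneg _) h1 2
  · have : (Matrix.gram ℝ v).det = 0 := by
      by_contra h
      exact hv (Matrix.linearIndependent_of_det_gram_ne_zero h)
    rw [this]
    positivity

end Hadamard

/-! ### Quantitative linear independence near orthonormality. -/

section NearlyOrthonormal

variable {E : Type*} [NormedAddCommGroup E] [InnerProductSpace ℝ E] {ι : Type*} [Fintype ι]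
  [DecidableEq ι]

/-- The Gram matrix of `v` differs from the identity by at most `1 / (2 (card ι + 1))`
in each entry. -/
def NearlyOrthonormal (v : ι → E) : Prop :=
  ∀ i j, |inner ℝ (v i) (v j) - if i = j then 1 else 0| ≤ 1 / (2 * (Fintype.card ι + 1))

/-- Diagonal dominance: the Gram matrix errors contribute at most half of `∑ |c i|`, which is
absorbed on the left. The bound in the definition is chosen for this. -/
lemma NearlyOrthonormal.sum_abs_le {v : ι → E} (hv : NearlyOrthonormal v) (c : ι → ℝ) :
    ∑ i, |c i| ≤ 2 * ∑ i, |inner ℝ (v i) (∑ j, c j • v j)| := by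
  have h1 : ∀ i, |c i| ≤ |inner ℝ (v i) (∑ j, c j • v j)|
      + 1 / (2 * (Fintype.card ι + 1)) * ∑ j, |c j| := by
    intro i
    have hi : c i = inner ℝ (v i) (∑ j, c j • v j)
        - ∑ j, c j * (inner ℝ (v i) (v j) - if i = j then 1 else 0) := by
      simp [inner_sum, real_inner_smul_right, mul_sub, Finset.sum_sub_distrib]
    calc |c i| ≤ |inner ℝ (v i) (∑ j, c j • v j)|
          + |∑ j, c j * (inner ℝ (v i) (v j) - if i = j then 1 else 0)| := by
          conv_lhs => rw [hi]
          exact abs_sub _ _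
      _ ≤ _ := by
          rw [Finset.mul_sum]
          refine add_le_add le_rfl ((Finset.abs_sum_le_sum_abs _ _).trans
            (Finset.sum_le_sum fun j _ => ?_))
          rw [abs_mul, mul_comm]
          exact mul_le_mul_of_nonneg_right (hv i j) (abs_nonneg _)
  have h2 := Finset.sum_le_sum fun i (_ : i ∈ Finset.univ) => h1 i
  rw [Finset.sum_add_distrib, Finset.sum_const, Finset.card_univ, nsmul_eq_mul] at h2
  have h3 : (Fintype.card ι : ℝ) * (1 / (2 * (Fintype.card ι + 1)) * ∑ j, |c j|)
      ≤ 1 / 2 * ∑ j, |c j| := by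
    rw [← mul_assoc]
    refine mul_le_mul_of_nonneg_right ?_ (Finset.sum_nonneg fun _ _ => abs_nonneg _)
    rw [mul_one_div, div_le_div_iff₀ (by positivity) (by positivity)]
    nlinarith
  linarith

lemma NearlyOrthonormal.linearIndependent {v : ι → E} (hv : NearlyOrthonormal v) :
    LinearIndependent ℝ v := by
  rw [Fintype.linearIndependent_iff]
  intro c hc i
  have h := hv.sum_abs_le c
  simp only [hc, inner_zero_right, abs_zero, Finset.sum_const_zero, mul_zero] at h
  have h2 := Finset.single_le_sum (f := fun i => |c i|) (fun j _ => abs_nonneg _)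
    (Finset.mem_univ i)
  exact abs_eq_zero.1 (le_antisymm (h2.trans h) (abs_nonneg _))

/-- The constant does not depend on `v`, so the estimate applies uniformly to a moving frame in
moving fibres. -/
lemma NearlyOrthonormal.norm_le {v : ι → E} (hv : NearlyOrthonormal v) {x : E}
    (hx : x ∈ Submodule.span ℝ (Set.range v)) : ‖x‖ ≤ 4 * ∑ i, |inner ℝ (v i) x| := by
  obtain ⟨c, rfl⟩ := (Submodule.mem_span_range_iff_exists_fun ℝ).1 hx
  have hn : ∀ i, ‖v i‖ ≤ 2 := by
    intro i
    have h := hv i i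
    rw [if_pos rfl, real_inner_self_eq_norm_sq] at h
    have h2 : (1 : ℝ) / (2 * (Fintype.card ι + 1)) ≤ 1 := by
      rw [div_le_one (by positivity)]
      have : (0 : ℝ) ≤ Fintype.card ι := by positivity
      linarith
    have h3 := (le_abs_self _).trans (h.trans h2)
    nlinarith [norm_nonneg (v i)]
  calc ‖∑ j, c j • v j‖ ≤ ∑ j, |c j| * 2 := by
        refine (norm_sum_le _ _).trans (Finset.sum_le_sum fun j _ => ?_)
        rw [norm_smul, Real.norm_eq_abs]
        exact mul_le_mul_of_nonneg_left (hn j) (abs_nonneg _)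
    _ ≤ _ := by
        rw [← Finset.sum_mul]
        linarith [hv.sum_abs_le c]

end NearlyOrthonormal

/-! ### Abstract Lagrangian families and their vertical spaces. -/

/-- An abstract space of Jacobi fields with self-adjoint Riccati operator: `ev t J = J(t)`,
`dv t J = J'(t)` and `R t` is the curvature operator. -/
structure LagrangianFamily (L : Type*) [AddCommGroup L] [Module ℝ L] (E : ℝ → Type*)
    [∀ t, NormedAddCommGroup (E t)] [∀ t, InnerProductSpace ℝ (E t)] where
  ev : ∀ t, L →ₗ[ℝ] E t
  dv : ∀ t, L →ₗ[ℝ] E t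
  R : ∀ t, E t → E t
  hasDerivAt_ev : ∀ a b t, HasDerivAt (fun s => inner ℝ (ev s a) (ev s b))
    (inner ℝ (dv t a) (ev t b) + inner ℝ (ev t a) (dv t b)) t
  hasDerivAt_dv : ∀ a b t, HasDerivAt (fun s => inner ℝ (dv s a) (ev s b))
    (-inner ℝ (R t (ev t a)) (ev t b) + inner ℝ (dv t a) (dv t b)) t
  symm : ∀ a b t, inner ℝ (dv t a) (ev t b) = inner ℝ (ev t a) (dv t b)
  eq_zero : ∀ a t, ev t a = 0 → dv t a = 0 → a = 0

namespace LagrangianFamily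

variable {L : Type*} [AddCommGroup L] [Module ℝ L] {E : ℝ → Type*}
  [∀ t, NormedAddCommGroup (E t)] [∀ t, InnerProductSpace ℝ (E t)] (F : LagrangianFamily L E)

/-- The vertical space spanned by a subspace `U` of fields. -/
def vert (U : Submodule ℝ L) (t : ℝ) : Submodule ℝ (E t) :=
  U.map (F.ev t) ⊔ (U ⊓ LinearMap.ker (F.ev t)).map (F.dv t)

variable {F}

lemma ev_mem_vert {U : Submodule ℝ L} {a : L} (ha : a ∈ U) (t : ℝ) : F.ev t a ∈ F.vert U t :=
  Submodule.mem_sup_left (Submodule.mem_map_of_mem ha)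

lemma dv_mem_vert {U : Submodule ℝ L} {a : L} {t : ℝ} (ha : a ∈ U) (h : F.ev t a = 0) :
    F.dv t a ∈ F.vert U t :=
  Submodule.mem_sup_right (Submodule.mem_map_of_mem ⟨ha, h⟩)

lemma mem_vert {U : Submodule ℝ L} {t : ℝ} {x : E t} :
    x ∈ F.vert U t ↔ ∃ a ∈ U, ∃ l ∈ U, F.ev t l = 0 ∧ F.ev t a + F.dv t l = x := by
  simp only [vert, Submodule.mem_sup, Submodule.mem_map, Submodule.mem_inf, LinearMap.mem_ker]
  constructor
  · rintro ⟨_, ⟨a, ha, rfl⟩, _, ⟨l, ⟨hl, hl0⟩, rfl⟩, rfl⟩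
    exact ⟨a, ha, l, hl, hl0, rfl⟩
  · rintro ⟨a, ha, l, hl, hl0, rfl⟩
    exact ⟨_, ⟨a, ha, rfl⟩, _, ⟨l, ⟨hl, hl0⟩, rfl⟩, rfl⟩

lemma inner_dv_ev_eq_zero {l : L} {t : ℝ} (h : F.ev t l = 0) (a : L) :
    inner ℝ (F.dv t l) (F.ev t a) = 0 := by
  rw [F.symm, h, inner_zero_left]

lemma inner_ev_dv_eq_zero {l : L} {t : ℝ} (h : F.ev t l = 0) (a : L) :
    inner ℝ (F.ev t a) (F.dv t l) = 0 := by
  rw [real_inner_comm, inner_dv_ev_eq_zero h]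

lemma hasDerivAt_inner_ev (a b : L) (t : ℝ) :
    HasDerivAt (fun s => inner ℝ (F.ev s a) (F.ev s b)) (2 * inner ℝ (F.dv t a) (F.ev t b)) t :=
  (F.hasDerivAt_ev a b t).congr_deriv (by rw [F.symm a b]; ring)

lemma tendsto_inner_div {l : L} {t₀ : ℝ} (h : F.ev t₀ l = 0) (a : L) :
    Tendsto (fun t => inner ℝ (F.ev t l) (F.ev t a) / (t - t₀)) (𝓝[≠] t₀) (𝓝 0) := by
  have hd := hasDerivAt_inner_ev (F := F) l a t₀
  rw [inner_dv_ev_eq_zero h, mul_zero] at hd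
  refine (hasDerivAt_iff_tendsto_slope.1 hd).congr fun t => ?_
  rw [slope_def_field, h, inner_zero_left, sub_zero]

lemma tendsto_inner_div_sq {l : L} {t₀ : ℝ} (h : F.ev t₀ l = 0) (a : L) :
    Tendsto (fun t => inner ℝ (F.ev t l) (F.ev t a) / (t - t₀) ^ 2) (𝓝[≠] t₀)
      (𝓝 (inner ℝ (F.dv t₀ l) (F.dv t₀ a))) := by
  have h1 : ∀ t, HasDerivAt (fun s => inner ℝ (F.ev s l) (F.ev s a))
      (2 * inner ℝ (F.dv t a) (F.ev t l)) t := fun t =>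
    (hasDerivAt_inner_ev l a t).congr_deriv (by rw [F.symm l a, real_inner_comm])
  have h2 := (F.hasDerivAt_dv a l t₀).const_mul 2
  have := tendsto_div_sq_of_hasDerivAt (.of_forall h1) h2 (by simp [h]) (by simp [h])
  convert this using 2
  rw [h, inner_zero_right, real_inner_comm]
  ring

/-- The vectors `l i (t) / (t - t₀)`, extended by the derivative of `l i` at `t₀`, together with
`k j (t)`. -/
noncomputable def frame (F : LagrangianFamily L E) (t₀ : ℝ) {p d : ℕ} (l : Fin p → L)
    (k : Fin d → L) (t : ℝ) : Fin p ⊕ Fin d → E t :=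
  Sum.elim (fun i => if t = t₀ then F.dv t (l i) else (t - t₀)⁻¹ • F.ev t (l i))
    fun j => F.ev t (k j)

section Frame

variable {t₀ : ℝ} {p d : ℕ} {l : Fin p → L} {k : Fin d → L}

lemma frame_inl_self (i : Fin p) : F.frame t₀ l k t₀ (.inl i) = F.dv t₀ (l i) := by simp [frame]

lemma frame_inl_of_ne {t : ℝ} (h : t ≠ t₀) (i : Fin p) :
    F.frame t₀ l k t (.inl i) = (t - t₀)⁻¹ • F.ev t (l i) := by simp [frame, h]

lemma frame_inr (t : ℝ) (j : Fin d) : F.frame t₀ l k t (.inr j) = F.ev t (k j) := rfl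

lemma continuousAt_inner_frame_ev (hl : ∀ i, F.ev t₀ (l i) = 0) (a : L) (i : Fin p ⊕ Fin d) :
    ContinuousAt (fun t => inner ℝ (F.frame t₀ l k t i) (F.ev t a)) t₀ := by
  rcases i with i | j
  · rw [continuousAt_iff_punctured_nhds, frame_inl_self, inner_dv_ev_eq_zero (hl i)]
    refine (tendsto_inner_div (hl i) a).congr' ?_
    filter_upwards [self_mem_nhdsWithin] with t ht
    rw [frame_inl_of_ne ht, real_inner_smul_left, div_eq_inv_mul]
  · exact (hasDerivAt_inner_ev (k j) a t₀).continuousAt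

lemma continuousAt_inner_frame (hl : ∀ i, F.ev t₀ (l i) = 0) (i j : Fin p ⊕ Fin d) :
    ContinuousAt (fun t => inner ℝ (F.frame t₀ l k t i) (F.frame t₀ l k t j)) t₀ := by
  rcases j with j | j
  · rcases i with i | i
    · rw [continuousAt_iff_punctured_nhds, frame_inl_self, frame_inl_self]
      refine (tendsto_inner_div_sq (hl i) (l j)).congr' ?_
      filter_upwards [self_mem_nhdsWithin] with t ht
      rw [frame_inl_of_ne ht, frame_inl_of_ne ht, real_inner_smul_left, real_inner_smul_right,
        div_eq_inv_mul, sq, mul_inv, mul_assoc]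
    · simp only [frame_inr, real_inner_comm _ (F.ev _ (k i))]
      exact continuousAt_inner_frame_ev hl (k i) (.inl j)
  · exact continuousAt_inner_frame_ev hl (k j) i

/-- Each product vanishes at `t₀` and has zero derivative there. For the rescaled fields the
difference quotient is `⟨l(t), q(t)⟩ / (t - t₀)²`, with limit `⟨l', q'⟩ = 0`; for the others
self-adjointness moves the derivative onto `q`. -/
lemma isLittleO_inner_frame (hl : ∀ i, F.ev t₀ (l i) = 0) {q : L} (hq : F.dv t₀ q = 0)
    (h0 : ∀ j, inner ℝ (F.ev t₀ (k j)) (F.ev t₀ q) = 0) (i : Fin p ⊕ Fin d) :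
    (fun t => inner ℝ (F.frame t₀ l k t i) (F.ev t q)) =o[𝓝 t₀] fun t => t - t₀ := by
  suffices h : HasDerivAt (fun t => inner ℝ (F.frame t₀ l k t i) (F.ev t q)) 0 t₀ by
    have h' := hasDerivAt_iff_isLittleO.1 h
    have hz : inner ℝ (F.frame t₀ l k t₀ i) (F.ev t₀ q) = 0 := by
      rcases i with i | j
      · rw [frame_inl_self, inner_dv_ev_eq_zero (hl i)]
      · exact h0 j
    simpa [hz] using h'
  rcases i with i | j
  · rw [hasDerivAt_iff_tendsto_slope]
    have := tendsto_inner_div_sq (hl i) q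
    rw [hq, inner_zero_right] at this
    refine this.congr' ?_
    filter_upwards [self_mem_nhdsWithin] with t ht
    rw [slope_def_field, frame_inl_self, inner_dv_ev_eq_zero (hl i), sub_zero, frame_inl_of_ne ht,
      real_inner_smul_left, ← div_eq_inv_mul, div_div, sq]
  · exact (hasDerivAt_inner_ev (k j) q t₀).congr_deriv (by rw [F.symm, hq, inner_zero_right,
      mul_zero])

lemma eventually_nearlyOrthonormal_frame (hl : ∀ i, F.ev t₀ (l i) = 0)
    (ho : Orthonormal ℝ (F.frame t₀ l k t₀)) :
    ∀ᶠ t in 𝓝 t₀, NearlyOrthonormal (F.frame t₀ l k t) := by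
  unfold NearlyOrthonormal
  simp only [eventually_all]
  intro i j
  have hc := continuousAt_inner_frame (k := k) hl i j
  have h1 : Tendsto (fun t => |inner ℝ (F.frame t₀ l k t i) (F.frame t₀ l k t j)
      - if i = j then (1 : ℝ) else 0|) (𝓝 t₀) (𝓝 0) := by
    have := (hc.tendsto.sub_const (if i = j then (1 : ℝ) else 0)).abs
    rwa [orthonormal_iff_ite.1 ho i j, sub_self, abs_zero] at this
  exact (h1.eventually_lt tendsto_const_nhds (by positivity)).mono fun t ht => ht.le

end Frame

lemma finrank_map_ev_add (F : LagrangianFamily L E) [FiniteDimensional ℝ L] (U : Submodule ℝ L)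
    (t : ℝ) : Module.finrank ℝ (U.map (F.ev t)) +
      Module.finrank ℝ (U ⊓ LinearMap.ker (F.ev t) : Submodule ℝ L) = Module.finrank ℝ U := by
  have h := LinearMap.finrank_range_add_finrank_ker ((F.ev t).domRestrict U)
  rw [LinearMap.range_domRestrict, LinearMap.ker_domRestrict] at h
  rw [← h, ← Submodule.map_comap_subtype, Submodule.finrank_map_subtype_eq]

lemma finrank_map_dv (F : LagrangianFamily L E) (U : Submodule ℝ L) (t : ℝ) :
    Module.finrank ℝ ((U ⊓ LinearMap.ker (F.ev t)).map (F.dv t)) =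
      Module.finrank ℝ (U ⊓ LinearMap.ker (F.ev t) : Submodule ℝ L) := by
  rw [← LinearMap.range_domRestrict]
  refine LinearMap.finrank_range_of_inj (LinearMap.ker_eq_bot.1 (LinearMap.ker_eq_bot'.2 ?_))
  rintro ⟨a, ha⟩ h
  exact Subtype.ext (F.eq_zero a t ha.2 h)

/-- By self-adjointness, derivatives of fields vanishing at `t₀` are orthogonal to all values at
`t₀`. Orthonormal bases of the two pieces of the vertical space therefore combine, and rank–nullity
with injectivity of `dv` on vanishing fields gives the count. -/
lemma exists_frame (F : LagrangianFamily L E) [FiniteDimensional ℝ L] (U : Submodule ℝ L)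
    (t₀ : ℝ) : ∃ (p d : ℕ) (l : Fin p → L) (k : Fin d → L), (∀ i, l i ∈ U) ∧
      (∀ i, F.ev t₀ (l i) = 0) ∧ (∀ j, k j ∈ U) ∧ Orthonormal ℝ (F.frame t₀ l k t₀) ∧
      p + d = Module.finrank ℝ U ∧
      Submodule.span ℝ (Set.range (F.frame t₀ l k t₀)) = F.vert U t₀ := by
  set A := (U ⊓ LinearMap.ker (F.ev t₀)).map (F.dv t₀) with hA
  set B := U.map (F.ev t₀) with hB
  let bA := stdOrthonormalBasis ℝ A
  let bB := stdOrthonormalBasis ℝ B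
  have hl : ∀ i, ∃ a, (a ∈ U ∧ F.ev t₀ a = 0) ∧ F.dv t₀ a = bA i := fun i =>
    Submodule.mem_map.1 (bA i).2
  have hk : ∀ j, ∃ a ∈ U, F.ev t₀ a = bB j := fun j => Submodule.mem_map.1 (bB j).2
  choose l hlU hl using hl
  choose k hkU hk using hk
  have hlu : ∀ i, F.frame t₀ l k t₀ (.inl i) = bA i := fun i => by rw [frame_inl_self, hl]
  have hku : ∀ j, F.frame t₀ l k t₀ (.inr j) = bB j := fun j => by rw [frame_inr, hk]
  refine ⟨_, _, l, k, fun i => (hlU i).1, fun i => (hlU i).2, hkU, ?_, ?_, ?_⟩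
  · rw [orthonormal_iff_ite]
    rintro (i | i) (j | j)
    · rw [hlu, hlu, ← Submodule.coe_inner, orthonormal_iff_ite.1 bA.orthonormal]
      simp
    · rw [frame_inl_self, frame_inr, inner_dv_ev_eq_zero (hlU i).2]
      simp
    · rw [frame_inl_self, frame_inr, inner_ev_dv_eq_zero (hlU j).2]
      simp
    · rw [hku, hku, ← Submodule.coe_inner, orthonormal_iff_ite.1 bB.orthonormal]
      simp
  · rw [← finrank_map_ev_add F U t₀, ← finrank_map_dv, add_comm]
  · have hr : Set.range (F.frame t₀ l k t₀) =
        (A.subtype '' Set.range bA) ∪ (B.subtype '' Set.range bB) := by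
      rw [← Set.range_comp, ← Set.range_comp, ← Set.Sum.elim_range]
      congr 1
      funext i
      rcases i with i | j
      · exact hlu i
      · exact hku j
    rw [hr, Submodule.span_union, Submodule.span_image, Submodule.span_image,
      ← OrthonormalBasis.coe_toBasis, ← OrthonormalBasis.coe_toBasis, Module.Basis.span_eq,
      Module.Basis.span_eq, Submodule.map_subtype_top, Submodule.map_subtype_top, sup_comm]
    rfl

instance finiteDimensional_vert [FiniteDimensional ℝ L] (U : Submodule ℝ L) (t : ℝ) :
    FiniteDimensional ℝ (F.vert U t) := by
  unfold vert
  infer_instance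

lemma finrank_vert (F : LagrangianFamily L E) [FiniteDimensional ℝ L] (U : Submodule ℝ L)
    (t : ℝ) : Module.finrank ℝ (F.vert U t) = Module.finrank ℝ U := by
  obtain ⟨p, d, l, k, -, -, -, ho, hpd, hspan⟩ := F.exists_frame U t
  rw [← hspan, finrank_span_eq_card ho.linearIndependent, ← hpd]
  simp

/-- The frame stays nearly orthonormal, hence independent. Off `t₀` it consists of multiples of
values of `U`, so a dimension count shows that it spans all of them and that evaluation is injective
on `U`. -/
lemma eventually_vert_eq_span [FiniteDimensional ℝ L] {U : Submodule ℝ L}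
    {t₀ : ℝ} {p d : ℕ} {l : Fin p → L} {k : Fin d → L} (hlU : ∀ i, l i ∈ U)
    (hl : ∀ i, F.ev t₀ (l i) = 0) (hkU : ∀ j, k j ∈ U) (ho : Orthonormal ℝ (F.frame t₀ l k t₀))
    (hpd : p + d = Module.finrank ℝ U)
    (hspan : Submodule.span ℝ (Set.range (F.frame t₀ l k t₀)) = F.vert U t₀) :
    ∀ᶠ t in 𝓝 t₀, NearlyOrthonormal (F.frame t₀ l k t) ∧
      Submodule.span ℝ (Set.range (F.frame t₀ l k t)) = F.vert U t ∧
      (t ≠ t₀ → ∀ a ∈ U, F.ev t a = 0 → a = 0) := by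
  filter_upwards [eventually_nearlyOrthonormal_frame hl ho] with t ht
  refine ⟨ht, ?_⟩
  by_cases htt : t = t₀
  · subst htt
    exact ⟨hspan, fun h => absurd rfl h⟩
  have hle : Submodule.span ℝ (Set.range (F.frame t₀ l k t)) ≤ U.map (F.ev t) := by
    rw [Submodule.span_le]
    rintro _ ⟨i | j, rfl⟩
    · rw [frame_inl_of_ne htt]
      exact Submodule.smul_mem _ _ (Submodule.mem_map_of_mem (hlU i))
    · exact Submodule.mem_map_of_mem (hkU j)
  have hcard : Module.finrank ℝ (Submodule.span ℝ (Set.range (F.frame t₀ l k t))) =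
      Module.finrank ℝ U := by
    rw [finrank_span_eq_card ht.linearIndependent, ← hpd]
    simp
  have hadd := finrank_map_ev_add F U t
  have heq : Submodule.span ℝ (Set.range (F.frame t₀ l k t)) = U.map (F.ev t) :=
    Submodule.eq_of_le_of_finrank_le hle (by omega)
  have hker : U ⊓ LinearMap.ker (F.ev t) = ⊥ := by
    rw [heq] at hcard
    exact Submodule.finrank_eq_zero.1 (by omega)
  refine ⟨?_, fun _ a ha h0 => ?_⟩
  · rw [heq, vert, hker, Submodule.map_bot, sup_bot_eq]
  · have : a ∈ U ⊓ LinearMap.ker (F.ev t) := ⟨ha, h0⟩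
    rwa [hker, Submodule.mem_bot] at this

/-- Near any given time no nonzero field vanishes, except possibly at that time. -/
lemma eventually_ev_injective (F : LagrangianFamily L E) [FiniteDimensional ℝ L] (t₀ : ℝ) :
    ∀ᶠ t in 𝓝[≠] t₀, Function.Injective (F.ev t) := by
  obtain ⟨p, d, l, k, hlU, hl, hkU, ho, hpd, hspan⟩ := F.exists_frame ⊤ t₀
  have h := eventually_vert_eq_span hlU hl hkU ho hpd hspan
  filter_upwards [nhdsWithin_le_nhds h, self_mem_nhdsWithin] with t ht htt
  exact LinearMap.ker_eq_bot.1 (LinearMap.ker_eq_bot'.2 fun a ha =>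
    ht.2.2 htt a Submodule.mem_top ha)

/-! ### Horizontal components and their continuity. -/

section Horizontal

variable [FiniteDimensional ℝ L] {U : Submodule ℝ L}

/-- The component of `J(t)` orthogonal to the vertical space. -/
noncomputable def hor (F : LagrangianFamily L E) (U : Submodule ℝ L) (t : ℝ) : L →ₗ[ℝ] E t :=
  F.ev t - (F.vert U t).starProjection.toLinearMap ∘ₗ F.ev t

lemma hor_apply (t : ℝ) (a : L) :
    F.hor U t a = F.ev t a - (F.vert U t).starProjection (F.ev t a) := rfl

lemma hor_mem_orthogonal (t : ℝ) (a : L) : F.hor U t a ∈ (F.vert U t)ᗮ :=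
  Submodule.sub_starProjection_mem_orthogonal _

lemma hor_eq_zero_of_mem {a : L} (ha : a ∈ U) (t : ℝ) : F.hor U t a = 0 := by
  rw [hor_apply, Submodule.starProjection_eq_self_iff.2 (ev_mem_vert ha t), sub_self]

lemma hor_eq_of_sub_mem {a b : L} (h : a - b ∈ U) (t : ℝ) : F.hor U t a = F.hor U t b := by
  rw [← sub_eq_zero, ← map_sub, hor_eq_zero_of_mem h]

lemma hor_eq_ev {a : L} {t : ℝ} (h : F.ev t a ∈ (F.vert U t)ᗮ) : F.hor U t a = F.ev t a := by
  rw [hor_apply, (Submodule.starProjection_apply_eq_zero_iff _).2 h, sub_zero]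

lemma inner_hor (t : ℝ) (a b : L) :
    inner ℝ (F.hor U t a) (F.hor U t b) = inner ℝ (F.ev t a) (F.ev t b)
      - inner ℝ ((F.vert U t).starProjection (F.ev t a))
        ((F.vert U t).starProjection (F.ev t b)) := by
  have h1 := Submodule.inner_right_of_mem_orthogonal
    (Submodule.starProjection_apply_mem (F.vert U t) (F.ev t a)) (hor_mem_orthogonal (F := F) t b)
  have h2 := Submodule.inner_left_of_mem_orthogonal
    (Submodule.starProjection_apply_mem (F.vert U t) (F.ev t b)) (hor_mem_orthogonal (F := F) t a)
  have ha : F.ev t a = F.hor U t a + (F.vert U t).starProjection (F.ev t a) := by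
    rw [hor_apply, sub_add_cancel]
  have hb : F.ev t b = F.hor U t b + (F.vert U t).starProjection (F.ev t b) := by
    rw [hor_apply, sub_add_cancel]
  conv_rhs => enter [1]; rw [ha, hb]
  simp only [inner_add_left, inner_add_right, h1, h2]
  ring

lemma norm_hor_le (t : ℝ) (a : L) : ‖F.hor U t a‖ ≤ ‖F.ev t a‖ := by
  have h := inner_hor (F := F) (U := U) t a a
  simp only [real_inner_self_eq_norm_sq] at h
  have h2 := sq_nonneg ‖(F.vert U t).starProjection (F.ev t a)‖
  exact (sq_le_sq₀ (norm_nonneg _) (norm_nonneg _)).1 (by linarith)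

/-- The projection is controlled by the inner products of `q` with the nearly orthonormal frame of
the vertical space. These tend to zero, and are `o(t - t₀)` when `q'(t₀) = 0`. -/
lemma tendsto_norm_starProjection {t₀ : ℝ} {q : L} (hq : F.ev t₀ q ∈ (F.vert U t₀)ᗮ) :
    Tendsto (fun t => ‖(F.vert U t).starProjection (F.ev t q)‖) (𝓝 t₀) (𝓝 0) ∧
    (F.dv t₀ q = 0 → (fun t => ‖(F.vert U t).starProjection (F.ev t q)‖) =o[𝓝 t₀]
      fun t => t - t₀) := by
  obtain ⟨p, d, l, k, hlU, hl, hkU, ho, hpd, hspan⟩ := F.exists_frame U t₀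
  have hev := eventually_vert_eq_span hlU hl hkU ho hpd hspan
  have hle : ∀ᶠ t in 𝓝 t₀, ‖(F.vert U t).starProjection (F.ev t q)‖ ≤
      4 * ∑ i, |inner ℝ (F.frame t₀ l k t i) (F.ev t q)| := by
    filter_upwards [hev] with t ⟨hn, hs, _⟩
    have hmem := Submodule.starProjection_apply_mem (F.vert U t) (F.ev t q)
    refine (hn.norm_le (hs.ge hmem)).trans (le_of_eq ?_)
    congr 1
    refine Finset.sum_congr rfl fun i _ => ?_
    have hi : F.frame t₀ l k t i ∈ F.vert U t := hs ▸ Submodule.subset_span ⟨i, rfl⟩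
    have h0 := Submodule.inner_right_of_mem_orthogonal hi (hor_mem_orthogonal (F := F) t q)
    rw [hor_apply, inner_sub_right, sub_eq_zero] at h0
    rw [h0]
  have hzero : ∀ i, inner ℝ (F.frame t₀ l k t₀ i) (F.ev t₀ q) = 0 := by
    intro i
    have hi : F.frame t₀ l k t₀ i ∈ F.vert U t₀ := hspan ▸ Submodule.subset_span ⟨i, rfl⟩
    exact Submodule.inner_right_of_mem_orthogonal hi hq
  constructor
  · have h1 : Tendsto (fun t => 4 * ∑ i, |inner ℝ (F.frame t₀ l k t i) (F.ev t q)|) (𝓝 t₀)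
        (𝓝 0) := by
      have := (tendsto_finsetSum Finset.univ fun i _ =>
        (continuousAt_inner_frame_ev (k := k) hl q i).abs.tendsto).const_mul 4
      simpa [hzero] using this
    exact squeeze_zero' (.of_forall fun t => norm_nonneg _) hle h1
  · intro hdq
    have h1 : (fun t => 4 * ∑ i, |inner ℝ (F.frame t₀ l k t i) (F.ev t q)|) =o[𝓝 t₀]
        fun t => t - t₀ :=
      (Asymptotics.IsLittleO.fun_sum fun i _ =>
        (isLittleO_inner_frame hl hdq (fun j => hzero (.inr j)) i).abs_left).const_mul_left 4
    refine Asymptotics.IsBigO.trans_isLittleO (Asymptotics.IsBigO.of_bound 1 ?_) h1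
    filter_upwards [hle] with t ht
    rw [one_mul, norm_norm]
    exact ht.trans (le_abs_self _)

/-- A first correction makes the field horizontal at `t`; no derivative term occurs, since
derivatives of vanishing fields are orthogonal to values. The remaining freedom, fields of `U`
vanishing at `t`, makes the derivative orthogonal to theirs. -/
lemma exists_lift (F : LagrangianFamily L E) (U : Submodule ℝ L) (a : L) (t : ℝ) :
    ∃ z ∈ U, F.ev t (a - z) ∈ (F.vert U t)ᗮ ∧
      ∀ l ∈ U, F.ev t l = 0 → inner ℝ (F.dv t (a - z)) (F.dv t l) = 0 := by
  obtain ⟨z, hz, l, hl, hl0, hzl⟩ := mem_vert.1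
    (Submodule.starProjection_apply_mem (F.vert U t) (F.ev t a))
  have hdl : F.dv t l = 0 := by
    have h := Submodule.inner_right_of_mem_orthogonal (dv_mem_vert hl hl0)
      (hor_mem_orthogonal (F := F) (U := U) t a)
    rw [hor_apply, ← hzl, inner_sub_right, inner_add_right, inner_dv_ev_eq_zero hl0,
      inner_dv_ev_eq_zero hl0] at h
    exact (inner_self_eq_zero (𝕜 := ℝ)).1 (by linarith)
  have hh : F.ev t (a - z) ∈ (F.vert U t)ᗮ := by
    have := hor_mem_orthogonal (F := F) (U := U) t a
    rwa [hor_apply, ← hzl, hdl, add_zero, ← map_sub] at this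
  obtain ⟨l', ⟨hl'U, hl'0⟩, hl'⟩ := Submodule.mem_map.1 (Submodule.starProjection_apply_mem
    ((U ⊓ LinearMap.ker (F.ev t)).map (F.dv t)) (F.dv t (a - z)))
  have hl'0 : F.ev t l' = 0 := hl'0
  refine ⟨z + l', U.add_mem hz hl'U, ?_, fun m hm hm0 => ?_⟩
  · rwa [← sub_sub, map_sub, hl'0, sub_zero]
  · rw [← sub_sub, map_sub, hl']
    have hm' : m ∈ U ⊓ LinearMap.ker (F.ev t) := ⟨hm, hm0⟩
    exact Submodule.inner_left_of_mem_orthogonal (Submodule.mem_map_of_mem hm')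
      (Submodule.sub_starProjection_mem_orthogonal _)

/-- Horizontal parts depend only on classes modulo `U`, so representatives already horizontal at
`t₀` may be used; their vertical projections tend to zero there. -/
lemma continuous_inner_hor (F : LagrangianFamily L E) (U : Submodule ℝ L) (a b : L) :
    Continuous fun t => inner ℝ (F.hor U t a) (F.hor U t b) := by
  rw [continuous_iff_continuousAt]
  intro t₀
  obtain ⟨z, hz, hza, -⟩ := F.exists_lift U a t₀
  obtain ⟨w, hw, hwb, -⟩ := F.exists_lift U b t₀
  have ha : ∀ t, F.hor U t a = F.hor U t (a - z) := hor_eq_of_sub_mem (by simpa using hz)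
  have hb : ∀ t, F.hor U t b = F.hor U t (b - w) := hor_eq_of_sub_mem (by simpa using hw)
  have h1 := (tendsto_norm_starProjection hza).1
  have h2 := (tendsto_norm_starProjection hwb).1
  have h3 : Tendsto (fun t => inner ℝ ((F.vert U t).starProjection (F.ev t (a - z)))
      ((F.vert U t).starProjection (F.ev t (b - w)))) (𝓝 t₀) (𝓝 0) := by
    have h12 := h1.mul h2
    rw [mul_zero] at h12
    refine squeeze_zero_norm (fun t => ?_) h12
    exact abs_real_inner_le_norm ((F.vert U t).starProjection (F.ev t (a - z)))
      ((F.vert U t).starProjection (F.ev t (b - w)))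
  have h4 := (hasDerivAt_inner_ev (F := F) (a - z) (b - w) t₀).continuousAt.tendsto.sub h3
  unfold ContinuousAt
  simp only [ha, hb]
  rw [hor_eq_ev hza, hor_eq_ev hwb]
  simpa only [inner_hor, sub_zero] using h4

end Horizontal

end LagrangianFamily

/-! ### Adapted frames and the barrier functions. -/

namespace LagrangianFamily

variable {L : Type*} [AddCommGroup L] [Module ℝ L] {E : ℝ → Type*}
  [∀ t, NormedAddCommGroup (E t)] [∀ t, InnerProductSpace ℝ (E t)] {F : LagrangianFamily L E}

/-- The fields which are optimal representatives at time `t` of their classes modulo `Z`. -/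
noncomputable def lifts (F : LagrangianFamily L E) (Z : Submodule ℝ L) (t : ℝ) : Submodule ℝ L :=
  (F.vert Z t)ᗮ.comap (F.ev t) ⊓ ((Z ⊓ LinearMap.ker (F.ev t)).map (F.dv t))ᗮ.comap (F.dv t)

lemma ev_mem_orthogonal_of_mem_lifts {Z : Submodule ℝ L} {t : ℝ} {q : L} (hq : q ∈ F.lifts Z t) :
    F.ev t q ∈ (F.vert Z t)ᗮ := hq.1

lemma inner_dv_of_mem_lifts {Z : Submodule ℝ L} {t : ℝ} {q l : L} (hq : q ∈ F.lifts Z t)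
    (hl : l ∈ Z) (h0 : F.ev t l = 0) : inner ℝ (F.dv t q) (F.dv t l) = 0 := by
  have hl' : l ∈ Z ⊓ LinearMap.ker (F.ev t) := ⟨hl, h0⟩
  exact Submodule.inner_left_of_mem_orthogonal (Submodule.mem_map_of_mem hl') hq.2

lemma eq_zero_of_mem_lifts {Z : Submodule ℝ L} {t : ℝ} {q : L} (hq : q ∈ F.lifts Z t)
    (hZ : q ∈ Z) (h0 : F.ev t q = 0) : q = 0 :=
  F.eq_zero q t h0 ((inner_self_eq_zero (𝕜 := ℝ)).1 (inner_dv_of_mem_lifts hq hZ h0))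

lemma isCompl_lifts [FiniteDimensional ℝ L] (F : LagrangianFamily L E) (Z : Submodule ℝ L)
    (t : ℝ) : IsCompl Z (F.lifts Z t) := by
  constructor
  · rw [Submodule.disjoint_def]
    intro a haZ ha
    refine eq_zero_of_mem_lifts ha haZ ?_
    exact (inner_self_eq_zero (𝕜 := ℝ)).1 (Submodule.inner_right_of_mem_orthogonal
      (ev_mem_vert haZ t) (ev_mem_orthogonal_of_mem_lifts ha))
  · rw [codisjoint_iff, eq_top_iff]
    rintro a -
    obtain ⟨z, hz, h1, h2⟩ := F.exists_lift Z a t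
    refine Submodule.mem_sup.2 ⟨z, hz, a - z, ⟨h1, ?_⟩, by abel⟩
    rintro _ ⟨l, ⟨hl, hl0⟩, rfl⟩
    rw [real_inner_comm]
    exact h2 l hl hl0

/-- A family of fields `J i` spanning a complement of `Z`, horizontal and orthonormal at time `t`,
which diagonalizes the transverse Riccati operator: the derivative of `J i` is
`lam i • J i + K i` with `K i ∈ Z`. -/
structure IsAdapted (F : LagrangianFamily L E) (Z : Submodule ℝ L) (t : ℝ) {m : ℕ}
    (J K : Fin m → L) (lam : Fin m → ℝ) : Prop where
  mem_orthogonal : ∀ i, F.ev t (J i) ∈ (F.vert Z t)ᗮ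
  orthonormal : Orthonormal ℝ fun i => F.ev t (J i)
  mem : ∀ i, K i ∈ Z
  dv_eq : ∀ i, F.dv t (J i) = lam i • F.ev t (J i) + F.ev t (K i)
  span : Submodule.span ℝ (Set.range J) ⊔ Z = ⊤

/-- Self-adjointness makes the transverse Riccati operator `T` on the horizontal values symmetric;
the `J i` lift its eigenbasis. Since `dim G = dim L`, the vertical space and `H` fill `G`, so `J i'`
has only an eigenvalue part and a vertical part. -/
lemma exists_isAdapted [FiniteDimensional ℝ L] (F : LagrangianFamily L E) {Z : Submodule ℝ L}
    {t : ℝ} (hZ : ∀ a, F.ev t a = 0 → a ∈ Z) {G : Submodule ℝ (E t)} [FiniteDimensional ℝ G]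
    (hev : ∀ a, F.ev t a ∈ G) (hdv : ∀ a, F.dv t a ∈ G)
    (hG : Module.finrank ℝ G = Module.finrank ℝ L) {m : ℕ}
    (hm : Module.finrank ℝ Z + m = Module.finrank ℝ L) :
    ∃ (J K : Fin m → L) (lam : Fin m → ℝ), F.IsAdapted Z t J K lam := by
  set Q := F.lifts Z t with hQ
  have hcompl : IsCompl Z Q := F.isCompl_lifts Z t
  have hinj : Function.Injective ((F.ev t).domRestrict Q) :=
    LinearMap.ker_eq_bot.1 (LinearMap.ker_eq_bot'.2 fun a ha =>
      Subtype.ext (eq_zero_of_mem_lifts a.2 (hZ _ ha) ha))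
  let H := LinearMap.range ((F.ev t).domRestrict Q)
  let e : Q ≃ₗ[ℝ] H := LinearEquiv.ofInjective _ hinj
  have he : ∀ x : H, F.ev t (e.symm x) = x := fun x =>
    congrArg Subtype.val (e.apply_symm_apply x)
  have hHm : Module.finrank ℝ H = m := by
    rw [← e.finrank_eq]
    have := Submodule.finrank_add_eq_of_isCompl hcompl
    omega
  have hHV : ∀ x ∈ H, x ∈ (F.vert Z t)ᗮ := by
    rintro _ ⟨a, rfl⟩
    exact ev_mem_orthogonal_of_mem_lifts a.2
  let T : H →ₗ[ℝ] H := H.orthogonalProjectionOnto.toLinearMap ∘ₗ F.dv t ∘ₗ Q.subtype ∘ₗ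
    e.symm.toLinearMap
  have hT : ∀ x y : H, inner ℝ (T x) y = inner ℝ (F.dv t (e.symm x)) (y : E t) := fun x y =>
    Submodule.inner_orthogonalProjectionOnto_eq_of_mem_right y _
  have hsymm : T.IsSymmetric := by
    intro x y
    calc inner ℝ (T x) y = inner ℝ (F.dv t (e.symm x)) (F.ev t (e.symm y)) := by rw [hT, he]
      _ = inner ℝ (F.ev t (e.symm x)) (F.dv t (e.symm y)) := F.symm _ _ t
      _ = inner ℝ x (T y) := by rw [he, real_inner_comm, ← hT, real_inner_comm]
  let b := hsymm.eigenvectorBasis hHm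
  let lam := hsymm.eigenvalues hHm
  have hTb : ∀ i, T (b i) = lam i • b i := fun i => hsymm.apply_eigenvectorBasis hHm i
  let J : Fin m → L := fun i => e.symm (b i)
  have hJ : ∀ i, F.ev t (J i) = b i := fun i => he (b i)
  have hK : ∀ i, ∃ z ∈ Z, F.ev t z = (F.vert Z t).starProjection (F.dv t (J i)) := by
    intro i
    obtain ⟨z, hz, l, hl, hl0, hzl⟩ := mem_vert.1
      (Submodule.starProjection_apply_mem (F.vert Z t) (F.dv t (J i)))
    have h := Submodule.inner_right_of_mem_orthogonal (dv_mem_vert hl hl0)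
      (Submodule.sub_starProjection_mem_orthogonal (K := F.vert Z t) (F.dv t (J i)))
    -- The second condition defining `lifts` removes the derivative term, so the vertical part of `J
    -- i'` is the value of a field in `Z`.
    rw [← hzl, inner_sub_right, inner_add_right, inner_dv_ev_eq_zero hl0, real_inner_comm,
      inner_dv_of_mem_lifts (e.symm (b i)).2 hl hl0] at h
    have hdl : F.dv t l = 0 := (inner_self_eq_zero (𝕜 := ℝ)).1 (by linarith)
    exact ⟨z, hz, by rw [← hzl, hdl, add_zero]⟩
  choose K hKZ hK using hK
  have hsup : F.vert Z t ⊔ H = G := by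
    have hVG : F.vert Z t ≤ G := by
      intro x hx
      obtain ⟨a, -, l, -, -, rfl⟩ := mem_vert.1 hx
      exact G.add_mem (hev a) (hdv l)
    have hHG : H ≤ G := by
      rintro _ ⟨a, rfl⟩
      exact hev a
    have hdisj : F.vert Z t ⊓ H = ⊥ := by
      rw [← disjoint_iff, Submodule.disjoint_def]
      intro x hxV hxH
      exact (inner_self_eq_zero (𝕜 := ℝ)).1
        (Submodule.inner_right_of_mem_orthogonal hxV (hHV x hxH))
    refine Submodule.eq_of_le_of_finrank_le (sup_le hVG hHG) ?_
    have := Submodule.finrank_sup_add_finrank_inf_eq (F.vert Z t) H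
    rw [hdisj, finrank_bot, F.finrank_vert, hHm] at this
    omega
  refine ⟨J, K, lam, fun i => hJ i ▸ hHV _ (b i).2, ?_, hKZ, fun i => ?_, ?_⟩
  · simp only [hJ]
    exact b.orthonormal.comp_linearIsometry H.subtypeₗᵢ
  · set x := F.dv t (J i) - F.ev t (K i) - lam i • F.ev t (J i) with hx
    have hxG : x ∈ G := G.sub_mem (G.sub_mem (hdv _) (hev _)) (G.smul_mem _ (hev _))
    have hxV : ∀ v ∈ F.vert Z t, inner ℝ v x = 0 := by
      intro v hv
      rw [hx, inner_sub_right, real_inner_smul_right, hK,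
        Submodule.inner_right_of_mem_orthogonal hv
          (Submodule.sub_starProjection_mem_orthogonal _),
        Submodule.inner_right_of_mem_orthogonal hv (hJ i ▸ hHV _ (b i).2), mul_zero, sub_zero]
    have hxH : ∀ y ∈ H, inner ℝ y x = 0 := by
      intro y hy
      have h1 : inner ℝ (F.dv t (J i)) y = lam i * inner ℝ (b i : E t) y := by
        have := hT (b i) ⟨y, hy⟩
        rw [hTb, real_inner_smul_left] at this
        exact this.symm
      have h2 : inner ℝ (F.ev t (K i)) y = 0 :=
        Submodule.inner_right_of_mem_orthogonal (ev_mem_vert (hKZ i) t) (hHV y hy)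
      rw [real_inner_comm, hx, inner_sub_left, inner_sub_left, real_inner_smul_left, h1, h2, hJ]
      ring
    have hx0 : inner ℝ x x = 0 := by
      obtain ⟨v, hv, y, hy, hvy⟩ := Submodule.mem_sup.1 (hsup.ge hxG)
      rw [← hvy, inner_add_left, hvy, hxV v hv, hxH y hy, add_zero]
    have := inner_self_eq_zero.1 hx0
    rw [hx, sub_sub, sub_eq_zero] at this
    rw [this, add_comm]
  · rw [eq_top_iff, ← hcompl.sup_eq_top, sup_comm Z]
    refine sup_le_sup_right ?_ Z
    intro q hq
    have h1 : e ⟨q, hq⟩ ∈ Submodule.span ℝ (Set.range b) := by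
      rw [← OrthonormalBasis.coe_toBasis, Module.Basis.span_eq]
      exact Submodule.mem_top
    obtain ⟨c, hc⟩ := (Submodule.mem_span_range_iff_exists_fun ℝ).1 h1
    refine (Submodule.mem_span_range_iff_exists_fun ℝ).2 ⟨c, ?_⟩
    have h2 := congrArg (fun x => ((e.symm x : Q) : L)) hc
    simpa [J] using h2

section Barrier

variable {Z : Submodule ℝ L} {t₀ : ℝ} {m : ℕ} {J K : Fin m → L} {lam : Fin m → ℝ}

lemma IsAdapted.inner_ev_K (h : F.IsAdapted Z t₀ J K lam) (i : Fin m) :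
    inner ℝ (F.ev t₀ (J i)) (F.ev t₀ (K i)) = 0 :=
  Submodule.inner_left_of_mem_orthogonal (ev_mem_vert (h.mem i) t₀) (h.mem_orthogonal i)

lemma IsAdapted.inner_self (h : F.IsAdapted Z t₀ J K lam) (i : Fin m) :
    inner ℝ (F.ev t₀ (J i)) (F.ev t₀ (J i)) = 1 := by
  rw [real_inner_self_eq_norm_sq, h.orthonormal.1 i, one_pow]

/-- The squared norm of the comparison field `J - (t - t₀) K`. -/
noncomputable def barrier (F : LagrangianFamily L E) (t₀ : ℝ) (J K : L) (t : ℝ) : ℝ :=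
  ‖F.ev t (J - (t - t₀) • K)‖ ^ 2

/-- The derivative of `barrier`. -/
noncomputable def barrierDeriv (F : LagrangianFamily L E) (t₀ : ℝ) (J K : L) (t : ℝ) : ℝ :=
  2 * inner ℝ (F.dv t J) (F.ev t J) - 2 * inner ℝ (F.ev t J) (F.ev t K)
    - 4 * ((t - t₀) * inner ℝ (F.dv t J) (F.ev t K))
    + 2 * ((t - t₀) * inner ℝ (F.ev t K) (F.ev t K))
    + 2 * ((t - t₀) ^ 2 * inner ℝ (F.dv t K) (F.ev t K))

lemma barrier_eq (J K : L) (t : ℝ) : F.barrier t₀ J K t = inner ℝ (F.ev t J) (F.ev t J)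
    - 2 * ((t - t₀) * inner ℝ (F.ev t J) (F.ev t K))
    + (t - t₀) ^ 2 * inner ℝ (F.ev t K) (F.ev t K) := by
  rw [barrier, ← real_inner_self_eq_norm_sq, map_sub, map_smul]
  simp only [inner_sub_left, inner_sub_right, real_inner_smul_left, real_inner_smul_right,
    real_inner_comm (F.ev t J) (F.ev t K)]
  ring

lemma hasDerivAt_sub_sq (t₀ t : ℝ) : HasDerivAt (fun s => (s - t₀) ^ 2) (2 * (t - t₀)) t := by
  simpa using ((hasDerivAt_id t).sub_const t₀).fun_pow 2

lemma hasDerivAt_barrier (J K : L) (t : ℝ) :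
    HasDerivAt (F.barrier t₀ J K) (F.barrierDeriv t₀ J K t) t := by
  have h1 : HasDerivAt (fun s => s - t₀) 1 t := (hasDerivAt_id t).sub_const t₀
  have h := ((hasDerivAt_inner_ev (F := F) J J t).sub
    ((h1.mul (hasDerivAt_inner_ev (F := F) J K t)).const_mul 2)).add
    ((hasDerivAt_sub_sq t₀ t).mul (hasDerivAt_inner_ev (F := F) K K t))
  refine (h.congr_deriv ?_).congr_of_eventuallyEq (.of_forall fun s => barrier_eq J K s)
  rw [barrierDeriv]
  ring

lemma hasDerivAt_barrierDeriv (J K : L) :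
    HasDerivAt (F.barrierDeriv t₀ J K)
      (2 * (-inner ℝ (F.R t₀ (F.ev t₀ J)) (F.ev t₀ J) + inner ℝ (F.dv t₀ J) (F.dv t₀ J))
      - 8 * inner ℝ (F.dv t₀ J) (F.ev t₀ K) + 2 * inner ℝ (F.ev t₀ K) (F.ev t₀ K)) t₀ := by
  have h1 : HasDerivAt (fun s => s - t₀) 1 t₀ := (hasDerivAt_id t₀).sub_const t₀
  have h := (((((F.hasDerivAt_dv J J t₀).const_mul 2).sub
    ((hasDerivAt_inner_ev (F := F) J K t₀).const_mul 2)).sub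
    ((h1.mul (F.hasDerivAt_dv J K t₀)).const_mul 4)).add
    ((h1.mul (hasDerivAt_inner_ev (F := F) K K t₀)).const_mul 2)).add
    (((hasDerivAt_sub_sq t₀ t₀).mul (F.hasDerivAt_dv K K t₀)).const_mul 2)
  refine h.congr_deriv ?_
  simp only [sub_self]
  ring

lemma IsAdapted.barrier_self (h : F.IsAdapted Z t₀ J K lam) (i : Fin m) :
    F.barrier t₀ (J i) (K i) t₀ = 1 := by
  simp [barrier, h.orthonormal.1 i]

lemma IsAdapted.barrierDeriv_self (h : F.IsAdapted Z t₀ J K lam) (i : Fin m) :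
    F.barrierDeriv t₀ (J i) (K i) t₀ = 2 * lam i := by
  simp only [barrierDeriv, sub_self, h.dv_eq, inner_add_left, real_inner_smul_left, h.inner_self,
    h.inner_ev_K, real_inner_comm (F.ev t₀ (J i)) (F.ev t₀ (K i))]
  ring

/-- The comparison field has derivative `λJ` and second derivative `-R(J) - 2K'` at `t₀`. The term
`-4‖K‖²` arises from `⟨K', J⟩ = ⟨K, J'⟩ = ‖K‖²`, by self-adjointness. -/
lemma IsAdapted.hasDerivAt_barrierDeriv (h : F.IsAdapted Z t₀ J K lam) (i : Fin m) :
    HasDerivAt (F.barrierDeriv t₀ (J i) (K i))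
      (2 * lam i ^ 2 - 2 * inner ℝ (F.R t₀ (F.ev t₀ (J i))) (F.ev t₀ (J i))
      - 4 * ‖F.ev t₀ (K i)‖ ^ 2) t₀ := by
  refine (LagrangianFamily.hasDerivAt_barrierDeriv (J i) (K i)).congr_deriv ?_
  simp only [h.dv_eq, inner_add_left, inner_add_right, real_inner_smul_left, real_inner_smul_right,
    h.inner_self, h.inner_ev_K, real_inner_comm (F.ev t₀ (J i)) (F.ev t₀ (K i)),
    real_inner_self_eq_norm_sq (F.ev t₀ (K i))]
  ring

end Barrier

end LagrangianFamily

namespace LagrangianFamily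

variable {L : Type*} [AddCommGroup L] [Module ℝ L] {E : ℝ → Type*}
  [∀ t, NormedAddCommGroup (E t)] [∀ t, InnerProductSpace ℝ (E t)] {F : LagrangianFamily L E}

/-- The curvature operators are symmetric on the values of the family. -/
lemma inner_R_comm (a b : L) (t : ℝ) :
    inner ℝ (F.R t (F.ev t a)) (F.ev t b) = inner ℝ (F.R t (F.ev t b)) (F.ev t a) := by
  have h1 := F.hasDerivAt_dv a b t
  have h2 : HasDerivAt (fun s => inner ℝ (F.dv s a) (F.ev s b))
      (-inner ℝ (F.R t (F.ev t b)) (F.ev t a) + inner ℝ (F.dv t b) (F.dv t a)) t :=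
    (F.hasDerivAt_dv b a t).congr_of_eventuallyEq
      (.of_forall fun s => (F.symm a b s).trans (real_inner_comm _ _))
  have h3 := h1.unique h2
  rw [real_inner_comm (F.dv t a)] at h3
  linarith

/-! ### The logarithmic barrier. -/

section LogBarrier

variable {Z : Submodule ℝ L} {m : ℕ} {t₀ : ℝ} {J K : Fin m → L} {lam : Fin m → ℝ}

/-- The logarithm of the barrier for the `2m`-th root of the horizontal volume. -/
noncomputable def logBarrier (F : LagrangianFamily L E) (t₀ : ℝ) (J K : Fin m → L) (t : ℝ) : ℝ :=
  (2 * m : ℝ)⁻¹ * ∑ i, Real.log (F.barrier t₀ (J i) (K i) t)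

/-- The derivative of `logBarrier`. -/
noncomputable def logBarrierDeriv (F : LagrangianFamily L E) (t₀ : ℝ) (J K : Fin m → L)
    (t : ℝ) : ℝ :=
  (2 * m : ℝ)⁻¹ * ∑ i, F.barrierDeriv t₀ (J i) (K i) t / F.barrier t₀ (J i) (K i) t

lemma IsAdapted.eventually_barrier_pos (h : F.IsAdapted Z t₀ J K lam) :
    ∀ᶠ t in 𝓝 t₀, ∀ i, 0 < F.barrier t₀ (J i) (K i) t := by
  rw [eventually_all]
  intro i
  refine (hasDerivAt_barrier (F := F) (t₀ := t₀) (J i) (K i) t₀).continuousAt.eventually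
    (lt_mem_nhds ?_)
  rw [h.barrier_self]
  exact one_pos

lemma IsAdapted.hasDerivAt_logBarrier (h : F.IsAdapted Z t₀ J K lam) :
    ∀ᶠ t in 𝓝 t₀, HasDerivAt (F.logBarrier t₀ J K) (F.logBarrierDeriv t₀ J K t) t := by
  filter_upwards [h.eventually_barrier_pos] with t ht
  exact (HasDerivAt.fun_sum fun i _ =>
    (hasDerivAt_barrier (J i) (K i) t).log (ht i).ne').const_mul _

lemma IsAdapted.logBarrier_self (h : F.IsAdapted Z t₀ J K lam) : F.logBarrier t₀ J K t₀ = 0 := by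
  simp [logBarrier, h.barrier_self]

lemma IsAdapted.logBarrierDeriv_self (h : F.IsAdapted Z t₀ J K lam) :
    F.logBarrierDeriv t₀ J K t₀ = (m : ℝ)⁻¹ * ∑ i, lam i := by
  simp only [logBarrierDeriv, h.barrier_self, h.barrierDeriv_self, div_one, ← Finset.mul_sum]
  rw [mul_inv]
  ring

lemma IsAdapted.hasDerivAt_logBarrierDeriv (h : F.IsAdapted Z t₀ J K lam) :
    HasDerivAt (F.logBarrierDeriv t₀ J K)
      (-((m : ℝ)⁻¹ * (∑ i, lam i ^ 2 + ∑ i, inner ℝ (F.R t₀ (F.ev t₀ (J i))) (F.ev t₀ (J i))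
        + 2 * ∑ i, ‖F.ev t₀ (K i)‖ ^ 2))) t₀ := by
  have hd := (HasDerivAt.fun_sum fun i (_ : i ∈ Finset.univ) => (h.hasDerivAt_barrierDeriv i).div
    (hasDerivAt_barrier (F := F) (t₀ := t₀) (J i) (K i) t₀)
    (by rw [h.barrier_self]; exact one_ne_zero)).const_mul (2 * m : ℝ)⁻¹
  refine hd.congr_deriv ?_
  simp only [h.barrier_self, h.barrierDeriv_self, Finset.mul_sum, ← Finset.sum_add_distrib,
    ← Finset.sum_neg_distrib]
  refine Finset.sum_congr rfl fun i _ => ?_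
  rw [mul_inv]
  ring

end LogBarrier

variable [FiniteDimensional ℝ L]

/-- The squared volume of the horizontal components of the fields `c i`. -/
noncomputable def horVolume (F : LagrangianFamily L E) (Z : Submodule ℝ L) {m : ℕ}
    (c : Fin m → L) (t : ℝ) : ℝ :=
  (Matrix.gram ℝ fun i => F.hor Z t (c i)).det

/-! ### The horizontal volume and its upper barriers. -/

section HorVolume

variable {Z : Submodule ℝ L} {m : ℕ} {c : Fin m → L}

lemma continuous_horVolume : Continuous (F.horVolume Z c) := by
  unfold horVolume
  exact Continuous.matrix_det (continuous_matrix fun i j => F.continuous_inner_hor Z (c i) (c j))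

/-- Modulo `Z` the change of frame has constant coefficients, so the squared volumes differ by the
squared determinant, independently of `t`. This lets a fixed `c` be compared with a frame adapted at
any `t₀`. -/
lemma exists_horVolume_mul (hc : Submodule.span ℝ (Set.range c) ⊔ Z = ⊤) (J : Fin m → L) :
    ∃ r : ℝ, 0 ≤ r ∧ ∀ t, F.horVolume Z J t = r * F.horVolume Z c t := by
  have hB : ∀ i, ∃ B : Fin m → ℝ, J i - ∑ j, B j • c j ∈ Z := by
    intro i
    have hi : J i ∈ Submodule.span ℝ (Set.range c) ⊔ Z := hc ▸ Submodule.mem_top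
    obtain ⟨x, hx, z, hz, hxz⟩ := Submodule.mem_sup.1 hi
    obtain ⟨B, rfl⟩ := (Submodule.mem_span_range_iff_exists_fun ℝ).1 hx
    exact ⟨B, by rw [← hxz]; simpa using hz⟩
  choose B hB using hB
  refine ⟨(Matrix.of B).det ^ 2, sq_nonneg _, fun t => ?_⟩
  have hJ : ∀ i, F.hor Z t (J i) = ∑ j, B i j • F.hor Z t (c j) := by
    intro i
    rw [hor_eq_of_sub_mem (hB i) t]
    simp
  have hgram : (Matrix.gram ℝ fun i => F.hor Z t (J i)) =
      Matrix.of B * (Matrix.gram ℝ fun i => F.hor Z t (c i)) * (Matrix.of B).transpose := by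
    ext i j
    simp only [Matrix.gram_apply, hJ, Matrix.mul_apply, Matrix.transpose_apply, Matrix.of_apply,
      sum_inner, inner_sum, real_inner_smul_left, real_inner_smul_right, Finset.sum_mul]
    exact Finset.sum_congr rfl fun a _ => Finset.sum_congr rfl fun b _ => by ring
  rw [horVolume, hgram, Matrix.det_mul, Matrix.det_mul, Matrix.det_transpose, horVolume]
  ring

lemma IsAdapted.horVolume_self {t₀ : ℝ} {J K : Fin m → L} {lam : Fin m → ℝ}
    (h : F.IsAdapted Z t₀ J K lam) : F.horVolume Z J t₀ = 1 := by
  have : (Matrix.gram ℝ fun i => F.hor Z t₀ (J i)) = 1 := by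
    rw [Matrix.gram_eq_one_iff_orthonormal]
    simpa only [hor_eq_ev (h.mem_orthogonal _)] using h.orthonormal
  rw [horVolume, this, Matrix.det_one]

/-- Hadamard's inequality, after replacing `J i` by `J i - (t - t₀) • K i`, which has the same
horizontal part; projection does not increase norms. -/
lemma IsAdapted.horVolume_le_prod {t₀ : ℝ} {J K : Fin m → L} {lam : Fin m → ℝ}
    (h : F.IsAdapted Z t₀ J K lam) (t : ℝ) :
    F.horVolume Z J t ≤ ∏ i, F.barrier t₀ (J i) (K i) t := by
  refine (det_gram_le_prod_norm_sq _).trans (Finset.prod_le_prod (fun i _ => sq_nonneg _)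
    fun i _ => pow_le_pow_left₀ (norm_nonneg _) ?_ 2)
  have hmem : J i - (J i - (t - t₀) • K i) ∈ Z := by
    rw [sub_sub_cancel]
    exact Z.smul_mem _ (h.mem i)
  rw [hor_eq_of_sub_mem hmem t]
  exact norm_hor_le t _

lemma horVolume_nonneg (t : ℝ) : 0 ≤ F.horVolume Z c t :=
  (Matrix.posSemidef_gram ℝ _).det_nonneg

lemma IsAdapted.horVolume_pos (hc : Submodule.span ℝ (Set.range c) ⊔ Z = ⊤) {t₀ : ℝ}
    {J K : Fin m → L} {lam : Fin m → ℝ} (h : F.IsAdapted Z t₀ J K lam) :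
    0 < F.horVolume Z c t₀ := by
  obtain ⟨r, hr, hJ⟩ := exists_horVolume_mul (F := F) hc J
  refine (horVolume_nonneg t₀).lt_of_ne fun h0 => ?_
  have := hJ t₀
  rw [h.horVolume_self, ← h0, mul_zero] at this
  exact one_ne_zero this

lemma IsAdapted.horVolume_le (hc : Submodule.span ℝ (Set.range c) ⊔ Z = ⊤) {t₀ : ℝ}
    {J K : Fin m → L} {lam : Fin m → ℝ} (h : F.IsAdapted Z t₀ J K lam) (t : ℝ) :
    F.horVolume Z c t ≤ F.horVolume Z c t₀ * ∏ i, F.barrier t₀ (J i) (K i) t := by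
  obtain ⟨r, hr, hJ⟩ := exists_horVolume_mul (F := F) hc J
  have h1 := hJ t₀
  rw [h.horVolume_self] at h1
  have h2 := h.horVolume_le_prod t
  rw [hJ t] at h2
  calc F.horVolume Z c t = F.horVolume Z c t₀ * (r * F.horVolume Z c t) := by
        rw [← mul_assoc, mul_comm _ r, ← h1, one_mul]
    _ ≤ _ := mul_le_mul_of_nonneg_left h2 (horVolume_nonneg t₀)

end HorVolume

/-! ### Constancy of the volume and its consequences. -/

section Rigidity

variable {Z : Submodule ℝ L} {m : ℕ}

/-- If the trace of the curvature over every adapted frame is nonnegative, then all transverse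
Riccati operators vanish. -/
theorem rigidity (hm : 1 ≤ m)
    (hex : ∀ t, ∃ (J K : Fin m → L) (lam : Fin m → ℝ), F.IsAdapted Z t J K lam)
    (hRic : ∀ t (J K : Fin m → L) (lam : Fin m → ℝ), F.IsAdapted Z t J K lam →
      0 ≤ ∑ i, inner ℝ (F.R t (F.ev t (J i))) (F.ev t (J i)))
    {t₀ : ℝ} {J K : Fin m → L} {lam : Fin m → ℝ} (h : F.IsAdapted Z t₀ J K lam) :
    (∀ i, F.dv t₀ (J i) = 0) ∧ ∑ i, inner ℝ (F.R t₀ (F.ev t₀ (J i))) (F.ev t₀ (J i)) = 0 := by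
  obtain ⟨c, _, _, hc⟩ := hex 0
  have hc := hc.span
  have hm0 : (0 : ℝ) < m := by exact_mod_cast hm
  have hpos : ∀ t, 0 < F.horVolume Z c t := fun t => by
    obtain ⟨_, _, _, h⟩ := hex t
    exact h.horVolume_pos hc
  -- `horVolume` is a squared volume, so the exponent `1/(2m)` makes `u` the `m`-th root of the
  -- volume.
  let u : ℝ → ℝ := fun t => Real.exp ((2 * m : ℝ)⁻¹ * Real.log (F.horVolume Z c t))
  have hu : Continuous u := by
    refine Real.continuous_exp.comp (continuous_const.mul ?_)
    exact continuous_horVolume.log fun t => (hpos t).ne'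
  have hle : ∀ {t₀ : ℝ} {J K : Fin m → L} {lam : Fin m → ℝ}, F.IsAdapted Z t₀ J K lam →
      ∀ᶠ t in 𝓝 t₀, u t ≤ u t₀ * Real.exp (F.logBarrier t₀ J K t) := by
    intro t₀ J K lam h
    filter_upwards [h.eventually_barrier_pos] with t ht
    have hprod : 0 < ∏ i, F.barrier t₀ (J i) (K i) t := Finset.prod_pos fun i _ => ht i
    have h1 := Real.log_le_log (hpos t) (h.horVolume_le hc t)
    rw [Real.log_mul (hpos t₀).ne' hprod.ne', Real.log_prod fun i _ => (ht i).ne'] at h1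
    rw [← Real.exp_add, logBarrier, ← mul_add]
    exact Real.exp_le_exp.2 (mul_le_mul_of_nonneg_left h1 (by positivity))
  have hbar : ∀ t, HasConcaveBarrierAt u t := by
    intro t
    obtain ⟨J, K, lam, h⟩ := hex t
    refine ⟨_, _, _, h.hasDerivAt_logBarrier, h.hasDerivAt_logBarrierDeriv, h.logBarrier_self, ?_,
      hle h⟩
    rw [h.logBarrierDeriv_self]
    -- Cauchy–Schwarz lets `-Σλᵢ²/m` absorb the square of the logarithmic derivative `Σλᵢ/m`; the
    -- root of order `m` is taken for this.
    have h1 : (∑ i, lam i) ^ 2 ≤ m * ∑ i, lam i ^ 2 := by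
      simpa using sq_sum_le_card_mul_sum_sq (s := Finset.univ) (f := lam)
    have h2 := hRic t J K lam h
    have h3 : 0 ≤ ∑ i, ‖F.ev t (K i)‖ ^ 2 := Finset.sum_nonneg fun i _ => sq_nonneg _
    have h4 : ((m : ℝ)⁻¹ * ∑ i, lam i) ^ 2 ≤ (m : ℝ)⁻¹ * ∑ i, lam i ^ 2 := by
      rw [mul_pow, sq (m : ℝ)⁻¹, mul_assoc]
      refine mul_le_mul_of_nonneg_left ?_ (by positivity)
      rwa [inv_mul_le_iff₀ hm0]
    have h5 : 0 ≤ (m : ℝ)⁻¹ * (∑ i, inner ℝ (F.R t (F.ev t (J i))) (F.ev t (J i))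
        + 2 * ∑ i, ‖F.ev t (K i)‖ ^ 2) := by positivity
    linarith
  have hconst := eq_of_hasConcaveBarrierAt hu (fun t => Real.exp_pos _) hbar
  -- With `u` constant, the barrier lies above its own value at `t₀`. The second derivative test
  -- then bounds a sum of three nonnegative terms by zero.
  have hmin : IsLocalMin (F.logBarrier t₀ J K) t₀ := by
    filter_upwards [hle h] with t ht
    rw [hconst t t₀] at ht
    have h1 : 1 ≤ Real.exp (F.logBarrier t₀ J K t) :=
      le_of_mul_le_mul_left ((mul_one (u t₀)).trans_le ht) (Real.exp_pos _ : 0 < u t₀)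
    rw [h.logBarrier_self]
    exact Real.one_le_exp_iff.1 h1
  have hnn := (nonneg_of_isLocalMin h.hasDerivAt_logBarrier h.hasDerivAt_logBarrierDeriv hmin).2
  have hsum : ∑ i, lam i ^ 2 + ∑ i, inner ℝ (F.R t₀ (F.ev t₀ (J i))) (F.ev t₀ (J i))
        + 2 * ∑ i, ‖F.ev t₀ (K i)‖ ^ 2 ≤ 0 := by
    by_contra! hlt
    have := mul_pos (inv_pos.2 hm0) hlt
    linarith
  have h1 : 0 ≤ ∑ i, lam i ^ 2 := Finset.sum_nonneg fun i _ => sq_nonneg _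
  have h2 := hRic t₀ J K lam h
  have h3 : 0 ≤ ∑ i, ‖F.ev t₀ (K i)‖ ^ 2 := Finset.sum_nonneg fun i _ => sq_nonneg _
  refine ⟨fun i => ?_, by linarith⟩
  have hlam : lam i = 0 := by
    have := (Finset.sum_eq_zero_iff_of_nonneg fun i _ => sq_nonneg (lam i)).1
      (show ∑ i, lam i ^ 2 = 0 by linarith) i (Finset.mem_univ i)
    exact pow_eq_zero_iff two_ne_zero |>.1 this
  have hK : F.ev t₀ (K i) = 0 := by
    have := (Finset.sum_eq_zero_iff_of_nonneg fun i _ => sq_nonneg ‖F.ev t₀ (K i)‖).1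
      (show ∑ i, ‖F.ev t₀ (K i)‖ ^ 2 = 0 by linarith) i (Finset.mem_univ i)
    exact norm_eq_zero.1 (pow_eq_zero_iff two_ne_zero |>.1 this)
  rw [h.dv_eq, hlam, hK, zero_smul, add_zero]

end Rigidity

/-- Ambient data for a Lagrangian family: subspaces containing all values and derivatives, of the
dimension of the family, over which the sums of `k` curvatures are nonnegative. -/
structure HasNonnegRicci (F : LagrangianFamily L E) (k : ℕ) (G : ∀ t, Submodule ℝ (E t)) :
    Prop where
  finite : ∀ t, FiniteDimensional ℝ (G t)
  ev_mem : ∀ t a, F.ev t a ∈ G t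
  dv_mem : ∀ t a, F.dv t a ∈ G t
  finrank : ∀ t, Module.finrank ℝ (G t) = Module.finrank ℝ L
  nonneg : ∀ t (w : Fin k → E t), Orthonormal ℝ w → (∀ i, w i ∈ G t) →
    0 ≤ ∑ i, inner ℝ (F.R t (w i)) (w i)

/-! ### Consequences of rigidity for the abstract family. -/

section Splitting

variable {k : ℕ} {G : ∀ t, Submodule ℝ (E t)} {Z : Submodule ℝ L}

lemma HasNonnegRicci.exists_adapted (hG : F.HasNonnegRicci k G) (hk : 1 ≤ k)
    (hZ : ∀ t a, F.ev t a = 0 → a ∈ Z) (hdim : Module.finrank ℝ Z + k ≤ Module.finrank ℝ L)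
    (t : ℝ) : ∃ (m : ℕ) (_ : k ≤ m) (J K : Fin m → L) (lam : Fin m → ℝ),
      F.IsAdapted Z t J K lam ∧ (∀ i, F.dv t (J i) = 0) ∧
      ∑ i, inner ℝ (F.R t (F.ev t (J i))) (F.ev t (J i)) = 0 := by
  obtain ⟨m, hm⟩ : ∃ m, Module.finrank ℝ Z + m = Module.finrank ℝ L :=
    ⟨_, Nat.add_sub_of_le (by omega)⟩
  have hkm : k ≤ m := by omega
  have hex : ∀ t, ∃ (J K : Fin m → L) (lam : Fin m → ℝ), F.IsAdapted Z t J K lam := fun t =>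
    have := hG.finite t
    F.exists_isAdapted (hZ t) (hG.ev_mem t) (hG.dv_mem t) (hG.finrank t) hm
  obtain ⟨J, K, lam, h⟩ := hex t
  refine ⟨m, hkm, J, K, lam, h, rigidity (hk.trans hkm) hex (fun t J K lam h => ?_) h⟩
  exact sum_nonneg_of_injective hk hkm fun f hf =>
    hG.nonneg t _ (h.orthonormal.comp f hf) fun i => hG.ev_mem t _

lemma HasNonnegRicci.exists_lift (hG : F.HasNonnegRicci k G) (hk : 1 ≤ k)
    (hZ : ∀ t a, F.ev t a = 0 → a ∈ Z) (hdim : Module.finrank ℝ Z + k ≤ Module.finrank ℝ L)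
    (t : ℝ) (a : L) : ∃ q : L, a - q ∈ Z ∧ F.ev t q ∈ (F.vert Z t)ᗮ ∧ F.dv t q = 0 := by
  obtain ⟨m, -, J, K, lam, h, hdv, -⟩ := hG.exists_adapted hk hZ hdim t
  have ha : a ∈ Submodule.span ℝ (Set.range J) ⊔ Z := h.span ▸ Submodule.mem_top
  obtain ⟨q, hq, z, hz, rfl⟩ := Submodule.mem_sup.1 ha
  refine ⟨q, by simpa using hz, ?_, ?_⟩
  · have hle : Submodule.span ℝ (Set.range J) ≤ (F.vert Z t)ᗮ.comap (F.ev t) := by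
      rw [Submodule.span_le]
      rintro _ ⟨i, rfl⟩
      exact h.mem_orthogonal i
    exact hle hq
  · have hle : Submodule.span ℝ (Set.range J) ≤ LinearMap.ker (F.dv t) := by
      rw [Submodule.span_le]
      rintro _ ⟨i, rfl⟩
      exact hdv i
    exact hle hq

lemma HasNonnegRicci.lt_of_pos (hG : F.HasNonnegRicci k G) (hk : 1 ≤ k)
    (hZ : ∀ t a, F.ev t a = 0 → a ∈ Z) (hpos : ∀ t (w : Fin k → E t), Orthonormal ℝ w →
      (∀ i, w i ∈ G t) → 0 < ∑ i, inner ℝ (F.R t (w i)) (w i)) :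
    Module.finrank ℝ L < Module.finrank ℝ Z + k := by
  by_contra! hdim
  obtain ⟨m, hkm, J, K, lam, h, -, hR⟩ := hG.exists_adapted hk hZ hdim 0
  refine (sum_pos_of_injective hk hkm fun f hf => ?_).ne' hR
  exact hpos 0 _ (h.orthonormal.comp f hf) fun i => hG.ev_mem 0 _

end Splitting

end LagrangianFamily

/-! ### The normal space of the geodesic. -/

section Normal

variable {n : ℕ} {M : Type*} [TopologicalSpace M] [ChartedSpace (EuclideanSpace ℝ (Fin n)) M]

instance finiteDimensional_tangentSpace (x : M) : FiniteDimensional ℝ (TangentSpace (𝓡 n) x) :=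
  inferInstanceAs (FiniteDimensional ℝ (EuclideanSpace ℝ (Fin n)))

lemma finrank_tangentSpace (x : M) : Module.finrank ℝ (TangentSpace (𝓡 n) x) = n :=
  finrank_euclideanSpace_fin (𝕜 := ℝ) (n := n)

variable [Bundle.RiemannianBundle (fun x : M => TangentSpace (𝓡 n) x)] {γ : ℝ → M}

/-- The orthogonal complement of the velocity. -/
noncomputable def normalSpace (γ : ℝ → M) (t : ℝ) : Submodule ℝ (TangentSpace (𝓡 n) (γ t)) :=
  (ℝ ∙ velocity n γ t)ᗮ

lemma mem_normalSpace {t : ℝ} {x : TangentSpace (𝓡 n) (γ t)} :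
    x ∈ normalSpace γ t ↔ inner ℝ x (velocity n γ t) = 0 := by
  rw [normalSpace, Submodule.mem_orthogonal_singleton_iff_inner_left]

variable [IsManifold (𝓡 n) ∞ M]

lemma finrank_normalSpace (hγ : IsUnitSpeedGeodesic n γ) (t : ℝ) :
    Module.finrank ℝ (normalSpace (n := n) γ t) + 1 = n := by
  have hv : velocity n γ t ≠ 0 := fun h => by simpa [h] using hγ.2.2 t
  have h := Submodule.finrank_add_finrank_orthogonal (ℝ ∙ velocity n γ t)
  rw [finrank_span_singleton hv, finrank_tangentSpace] at h
  rw [normalSpace]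
  omega

lemma orthonormal_cons_velocity (hγ : IsUnitSpeedGeodesic n γ) {t : ℝ} {k : ℕ}
    {w : Fin k → TangentSpace (𝓡 n) (γ t)} (hw : Orthonormal ℝ w)
    (hn : ∀ i, w i ∈ normalSpace γ t) :
    Orthonormal ℝ (Fin.cons (velocity n γ t) w : Fin (k + 1) → TangentSpace (𝓡 n) (γ t)) := by
  constructor
  · intro i
    refine Fin.cases ?_ (fun i => ?_) i
    · simpa using hγ.2.2 t
    · simpa using hw.1 i
  · intro i j
    induction i using Fin.cases with
    | zero =>
      induction j using Fin.cases with
      | zero => exact fun h => absurd rfl h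
      | succ j =>
        intro _
        simp only [Fin.cons_zero, Fin.cons_succ]
        rw [real_inner_comm]
        exact mem_normalSpace.1 (hn j)
    | succ i =>
      induction j using Fin.cases with
      | zero =>
        intro _
        simp only [Fin.cons_zero, Fin.cons_succ]
        exact mem_normalSpace.1 (hn i)
      | succ j =>
        intro h
        simp only [Fin.cons_succ]
        exact hw.2 fun hij => h (congrArg Fin.succ hij)

lemma sectionalCurvature_eq (hγ : IsUnitSpeedGeodesic n γ) {t : ℝ}
    {w : TangentSpace (𝓡 n) (γ t)} (hw : ‖w‖ = 1) (hn : w ∈ normalSpace γ t) (x₀ : M) :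
    sectionalCurvature x₀ (γ t) (velocity n γ t) w =
      inner ℝ (curvature x₀ (γ t) w (velocity n γ t) (velocity n γ t)) w := by
  have h := mem_normalSpace.1 hn
  rw [sectionalCurvature, real_inner_comm w (velocity n γ t), h, real_inner_self_eq_norm_sq,
    real_inner_self_eq_norm_sq, hw, hγ.2.2 t]
  norm_num

end Normal

/-! ### Jacobi fields as a Lagrangian family. -/

section Geometry

variable {n : ℕ} {M : Type*} [TopologicalSpace M] [ChartedSpace (EuclideanSpace ℝ (Fin n)) M]
  [IsManifold (𝓡 n) ∞ M] [Bundle.RiemannianBundle (fun x : M => TangentSpace (𝓡 n) x)]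
  {γ : ℝ → M} {Λ : Submodule ℝ (∀ t, TangentSpace (𝓡 n) (γ t))}

/-- First and second covariant derivatives, depending linearly on the field, of a space of Jacobi
fields. -/
structure JacobiDerivs (γ : ℝ → M) (Λ : Submodule ℝ (∀ t, TangentSpace (𝓡 n) (γ t))) where
  fst : ∀ _ : Λ, ∀ t, TangentSpace (𝓡 n) (γ t)
  snd : ∀ _ : Λ, ∀ t, TangentSpace (𝓡 n) (γ t)
  isCovDerivAlong_fst : ∀ J : Λ, IsCovDerivAlong γ J (fst J)
  isCovDerivAlong_snd : ∀ J : Λ, IsCovDerivAlong γ (fst J) (snd J)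
  jacobi : ∀ (J : Λ) (x₀ : M) (t : ℝ), γ t ∈ (chartAt (EuclideanSpace ℝ (Fin n)) x₀).source →
    snd J t = -curvature x₀ (γ t) (J.1 t) (velocity n γ t) (velocity n γ t)

lemma exists_jacobiDerivs (hJacobi : ∀ J ∈ Λ, IsJacobiField γ J) :
    Nonempty (JacobiDerivs γ Λ) := by
  have h : ∀ J : Λ, IsJacobiField γ J.1 := fun J => hJacobi J.1 J.2
  choose W A hW hA hJ using h
  exact ⟨⟨W, A, hW, hA, fun J x₀ t ht => eq_neg_of_add_eq_zero_left (hJ J x₀ t ht)⟩⟩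

/-- Evaluation of the fields in `Λ` at time `t`. -/
noncomputable def evalAt (Λ : Submodule ℝ (∀ t, TangentSpace (𝓡 n) (γ t))) (t : ℝ) :
    Λ →ₗ[ℝ] TangentSpace (𝓡 n) (γ t) :=
  LinearMap.proj t ∘ₗ Λ.subtype

/-- Evaluation of the covariant derivatives of the fields in `Λ` at time `t`. -/
noncomputable def JacobiDerivs.evalAt (D : JacobiDerivs γ Λ) (t : ℝ) :
    Λ →ₗ[ℝ] TangentSpace (𝓡 n) (γ t) where
  toFun J := D.fst J t
  map_add' J₁ J₂ := congrFun ((D.isCovDerivAlong_fst (J₁ + J₂)).unique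
    ((D.isCovDerivAlong_fst J₁).add (D.isCovDerivAlong_fst J₂))) t
  map_smul' c J := congrFun ((D.isCovDerivAlong_fst (c • J)).unique
    ((D.isCovDerivAlong_fst J).smul c)) t

variable [IsContMDiffRiemannianBundle (𝓡 n) ∞ (EuclideanSpace ℝ (Fin n))
  (fun x : M => TangentSpace (𝓡 n) x)]

lemma JacobiDerivs.eq_zero (D : JacobiDerivs γ Λ) (hγ : IsUnitSpeedGeodesic n γ) (J : Λ) {t : ℝ}
    (h0 : J.1 t = 0) (h1 : D.fst J t = 0) : J = 0 := by
  refine Subtype.ext (eq_zero_of_secondOrder hγ.1 (D.isCovDerivAlong_fst J)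
    (D.isCovDerivAlong_snd J) (fun t₀ => ?_) h0 h1)
  have ht₀ := mem_chart_source (EuclideanSpace ℝ (Fin n)) (γ t₀)
  obtain ⟨C, hC⟩ := exists_norm_curvature_le hγ ht₀
  refine ⟨C, ?_⟩
  filter_upwards [hC, eventually_mem_chart_source hγ.1.continuous.continuousAt ht₀] with t ht hs
  rw [D.jacobi J _ t hs, norm_neg]
  exact ht _

/-- The Lagrangian family attached to a space of Jacobi fields with self-adjoint Riccati
operator. -/
noncomputable def JacobiDerivs.toLagrangianFamily (D : JacobiDerivs γ Λ)
    (hγ : IsUnitSpeedGeodesic n γ) (hS : RiccatiSelfAdjoint γ Λ) :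
    LagrangianFamily Λ fun t => TangentSpace (𝓡 n) (γ t) where
  ev t := JacobiSplitting.evalAt Λ t
  dv t := D.evalAt t
  R t u := curvature (γ t) (γ t) u (velocity n γ t) (velocity n γ t)
  hasDerivAt_ev a b t :=
    (D.isCovDerivAlong_fst a).hasDerivAt_inner hγ.1 (D.isCovDerivAlong_fst b) t
  hasDerivAt_dv a b t := by
    refine ((D.isCovDerivAlong_snd a).hasDerivAt_inner hγ.1
      (D.isCovDerivAlong_fst b) t).congr_deriv ?_
    rw [D.jacobi a (γ t) t (mem_chart_source _ _), inner_neg_left]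
    rfl
  symm a b t := hS a.1 a.2 b.1 b.2 _ _ (D.isCovDerivAlong_fst a) (D.isCovDerivAlong_fst b) t
  eq_zero a t h0 h1 := D.eq_zero hγ a h0 h1

lemma JacobiDerivs.finiteDimensional (D : JacobiDerivs γ Λ) (hγ : IsUnitSpeedGeodesic n γ) :
    FiniteDimensional ℝ Λ := by
  refine Module.Finite.of_injective ((JacobiSplitting.evalAt Λ 0).prod (D.evalAt 0))
    (LinearMap.ker_eq_bot.1 (LinearMap.ker_eq_bot'.2 fun J hJ => ?_))
  have h := Prod.ext_iff.1 hJ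
  exact D.eq_zero hγ J h.1 h.2

lemma JacobiDerivs.fst_mem_normalSpace (D : JacobiDerivs γ Λ) (hγ : IsUnitSpeedGeodesic n γ)
    (hnormal : ∀ J ∈ Λ, ∀ t, inner ℝ (J t) (velocity n γ t) = 0) (J : Λ) (t : ℝ) :
    D.fst J t ∈ normalSpace γ t := by
  have h := (D.isCovDerivAlong_fst J).hasDerivAt_inner hγ.1 hγ.2.1 t
  have h0 : (fun s => inner ℝ (J.1 s) (velocity n γ s)) = fun _ => (0 : ℝ) :=
    funext fun s => hnormal J.1 J.2 s
  rw [h0] at h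
  have := h.unique (hasDerivAt_const t (0 : ℝ))
  rw [mem_normalSpace]
  simpa using this

lemma JacobiDerivs.snd_mem_normalSpace (D : JacobiDerivs γ Λ) (hγ : IsUnitSpeedGeodesic n γ)
    (hnormal : ∀ J ∈ Λ, ∀ t, inner ℝ (J t) (velocity n γ t) = 0) (J : Λ) (t : ℝ) :
    D.snd J t ∈ normalSpace γ t := by
  have h := (D.isCovDerivAlong_snd J).hasDerivAt_inner hγ.1 hγ.2.1 t
  have h0 : (fun s => inner ℝ (D.fst J s) (velocity n γ s)) = fun _ => (0 : ℝ) :=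
    funext fun s => mem_normalSpace.1 (D.fst_mem_normalSpace hγ hnormal J s)
  rw [h0] at h
  have := h.unique (hasDerivAt_const t (0 : ℝ))
  rw [mem_normalSpace]
  simpa using this

end Geometry

/-! ### Parallel representatives and orthogonality. -/

section Splitting

variable {n : ℕ} {M : Type*} [TopologicalSpace M] [ChartedSpace (EuclideanSpace ℝ (Fin n)) M]
  [IsManifold (𝓡 n) ∞ M] [Bundle.RiemannianBundle (fun x : M => TangentSpace (𝓡 n) x)]
  [IsContMDiffRiemannianBundle (𝓡 n) ∞ (EuclideanSpace ℝ (Fin n))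
    (fun x : M => TangentSpace (𝓡 n) x)]
  {γ : ℝ → M} {Λ : Submodule ℝ (∀ t, TangentSpace (𝓡 n) (γ t))}

lemma vanishingSpan_le {n : ℕ} {M : Type*} [TopologicalSpace M]
    [ChartedSpace (EuclideanSpace ℝ (Fin n)) M] {γ : ℝ → M}
    (Λ : Submodule ℝ (∀ t, TangentSpace (𝓡 n) (γ t))) : vanishingSpan γ Λ ≤ Λ :=
  Submodule.span_le.2 fun _ hJ => hJ.1

lemma JacobiDerivs.hasNonnegRicci (D : JacobiDerivs γ Λ) (hγ : IsUnitSpeedGeodesic n γ)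
    (hS : RiccatiSelfAdjoint γ Λ) {k : ℕ} (hRic : RicNonneg n k γ)
    (hdim : Module.finrank ℝ Λ + 1 = n)
    (hnormal : ∀ J ∈ Λ, ∀ t, inner ℝ (J t) (velocity n γ t) = 0) :
    have := D.finiteDimensional hγ
    (D.toLagrangianFamily hγ hS).HasNonnegRicci k (fun t => normalSpace γ t) := by
  intro
  refine ⟨fun t => inferInstance, fun t J => mem_normalSpace.2 (hnormal J.1 J.2 t),
    fun t J => D.fst_mem_normalSpace hγ hnormal J t, fun t => ?_, fun t w hw hn => ?_⟩
  · have := finrank_normalSpace hγ t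
    omega
  · have h := hRic t w (orthonormal_cons_velocity hγ hw hn) (γ t) (mem_chart_source _ _)
    simp only [sectionalCurvature_eq hγ (hw.1 _) (hn _)] at h
    exact h

/-- A field in `Λ` agrees modulo the fields vanishing somewhere with a parallel one, provided that
at each time it does so to first order. -/
lemma JacobiDerivs.exists_parallel (D : JacobiDerivs γ Λ) (hγ : IsUnitSpeedGeodesic n γ)
    (hS : RiccatiSelfAdjoint γ Λ) (hdim : Module.finrank ℝ Λ + 1 = n)
    (hnormal : ∀ J ∈ Λ, ∀ t, inner ℝ (J t) (velocity n γ t) = 0) (Z : Submodule ℝ Λ) (c : Λ)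
    (hlift : ∀ t, ∃ q : Λ, c - q ∈ Z ∧
      q.1 t ∈ ((D.toLagrangianFamily hγ hS).vert Z t)ᗮ ∧ D.fst q t = 0) :
    ∃ P : Λ, c - P ∈ Z ∧ IsCovDerivAlong γ P.1 0 := by
  have := D.finiteDimensional hγ
  set F := D.toLagrangianFamily hγ hS with hF
  choose q hqZ hq hq' using hlift
  let W : ∀ t, TangentSpace (𝓡 n) (γ t) := fun t => F.hor Z t c
  have hWhor : ∀ s t, W t = F.hor Z t (q s) := fun s t =>
    LagrangianFamily.hor_eq_of_sub_mem (hqZ s) t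
  have hWq : ∀ t, W t = (q t).1 t := fun t =>
    (hWhor t t).trans (LagrangianFamily.hor_eq_ev (hq t))
  -- Near `t₀`, `W` differs from `q t₀` by the vertical projection of the latter, which is `o(t -
  -- t₀)`, while `(q t₀)'(t₀) = 0`.
  have hWpar : IsCovDerivAlong γ W 0 := by
    refine isCovDerivAlong_zero_of_isLittleO hγ.1.continuous fun t₀ =>
      ⟨(q t₀).1, D.fst (q t₀), D.isCovDerivAlong_fst _, hq' t₀, hWq t₀, ?_⟩
    refine ((LagrangianFamily.tendsto_norm_starProjection (F := F) (hq t₀)).2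
      (hq' t₀)).congr_left fun t => ?_
    have : W t - (q t₀).1 t = -((F.vert Z t).starProjection (F.ev t (q t₀))) := by
      rw [hWhor t₀ t, LagrangianFamily.hor_apply]
      exact sub_sub_cancel_left _ _
    rw [this, norm_neg]
  have hWd : ∀ (b : Λ) t, inner ℝ (W t) (D.fst b t) = 0 := by
    intro b t
    have h := F.symm (q t) b t
    rw [show F.dv t (q t) = 0 from hq' t, inner_zero_left] at h
    rw [hWq t]
    exact h.symm
  have hWs : ∀ (b : Λ) t, inner ℝ (W t) (D.snd b t) = 0 := by
    intro b t
    have h := hWpar.hasDerivAt_inner hγ.1 (D.isCovDerivAlong_snd b) t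
    simp only [hWd] at h
    simpa using h.unique (hasDerivAt_const t (0 : ℝ))
  -- At a regular time the values of `Λ` fill the normal space, so `(q t)''(t)` is the value of some
  -- `b`. Symmetry of `R`, available on values of the family, gives `‖(q t)''‖² = -⟨R (q t), b⟩ =
  -- ⟨W, b''⟩ = 0`.
  have hsnd : ∀ t, Function.Injective (F.ev t) → D.snd (q t) t = 0 := by
    intro t hinj
    have hrange : LinearMap.range (F.ev t) = normalSpace γ t := by
      refine Submodule.eq_of_le_of_finrank_le ?_ ?_
      · rintro _ ⟨J, rfl⟩
        exact mem_normalSpace.2 (hnormal J.1 J.2 t)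
      · rw [LinearMap.finrank_range_of_inj hinj]
        have := finrank_normalSpace hγ t
        omega
    obtain ⟨b, hb⟩ := hrange.ge (D.snd_mem_normalSpace hγ hnormal (q t) t)
    have hsR : ∀ J : Λ, D.snd J t = -F.R t (F.ev t J) := fun J =>
      D.jacobi J (γ t) t (mem_chart_source _ _)
    have h1 := F.inner_R_comm (q t) b t
    have h2 := hWs b t
    rw [hWq t, hsR b, inner_neg_right, neg_eq_zero, real_inner_comm] at h2
    rw [show inner ℝ (F.R t (F.ev t b)) (F.ev t (q t)) = 0 from h2, hb, hsR, inner_neg_right,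
      neg_eq_zero] at h1
    rw [hsR, neg_eq_zero]
    exact (inner_self_eq_zero (𝕜 := ℝ)).1 h1
  -- Regular times fill a punctured neighbourhood of every time, so continuity covers the singular
  -- ones.
  have hcurv : ∀ (x₀ : M) (t : ℝ), γ t ∈ (chartAt (EuclideanSpace ℝ (Fin n)) x₀).source →
      curvature x₀ (γ t) (W t) (velocity n γ t) (velocity n γ t) = 0 := by
    intro x₀ t ht
    refine curvature_eq_zero_of_eventually hγ ht hWpar ?_
    filter_upwards [F.eventually_ev_injective t, nhdsWithin_le_nhds
      (eventually_mem_chart_source hγ.1.continuous.continuousAt ht)] with s hs hst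
    have := D.jacobi (q s) x₀ s hst
    rw [hsnd s hs, ← hWq s, eq_comm, neg_eq_zero] at this
    exact this
  -- Both fields satisfy the Jacobi equation, with equal value and zero derivative at time `0`.
  have hWq0 : W - (q 0).1 = 0 := by
    refine eq_zero_of_secondOrder hγ.1 (hWpar.sub (D.isCovDerivAlong_fst (q 0)))
      ((show IsCovDerivAlong γ 0 0 from (parallelFields γ).zero_mem).sub
        (D.isCovDerivAlong_snd (q 0))) (fun t₀ => ?_) (t₀ := 0) ?_ ?_
    · have ht₀ := mem_chart_source (EuclideanSpace ℝ (Fin n)) (γ t₀)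
      obtain ⟨C, hC⟩ := exists_norm_curvature_le hγ ht₀
      refine ⟨C, ?_⟩
      filter_upwards [hC, eventually_mem_chart_source hγ.1.continuous.continuousAt ht₀]
        with t ht hs
      have h := ht ((W - (q 0).1) t)
      rw [Pi.sub_apply, curvature_sub, hcurv _ t hs, zero_sub, ← D.jacobi (q 0) _ t hs] at h
      simpa using h
    · simp [hWq 0]
    · simp [hq' 0]
  refine ⟨q 0, hqZ 0, ?_⟩
  rwa [← sub_eq_zero.1 hWq0]

/-- For a field `J` with a zero, `⟨J, P⟩' = ⟨J', P⟩ = ⟨J, P'⟩ = 0`, so `⟨J, P⟩` keeps the value `0`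
it has at that zero; linearity does the rest. -/
lemma inner_eq_zero_of_mem_vanishingSpan (hγ : IsUnitSpeedGeodesic n γ)
    (D : JacobiDerivs γ Λ) (hS : RiccatiSelfAdjoint γ Λ) {P : ∀ t, TangentSpace (𝓡 n) (γ t)}
    (hP : P ∈ Λ) (hP' : IsCovDerivAlong γ P 0) {Z : ∀ t, TangentSpace (𝓡 n) (γ t)}
    (hZ : Z ∈ vanishingSpan γ Λ) (t : ℝ) : inner ℝ (Z t) (P t) = 0 := by
  induction hZ using Submodule.span_induction with
  | mem J hJ =>
    obtain ⟨hJ, s, hs⟩ := hJ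
    have hd : ∀ t, HasDerivAt (fun s => inner ℝ (J s) (P s)) 0 t := by
      intro t
      have hJ' := D.isCovDerivAlong_fst ⟨J, hJ⟩
      refine (hJ'.hasDerivAt_inner hγ.1 hP' t).congr_deriv ?_
      rw [hS J hJ P hP _ _ hJ' hP' t]
      simp
    have := is_const_of_deriv_eq_zero (fun t => (hd t).differentiableAt) (fun t => (hd t).deriv) t s
    simpa [hs] using this
  | zero => simp
  | add J₁ J₂ _ _ h₁ h₂ => rw [Pi.add_apply, inner_add_left, h₁, h₂, add_zero]
  | smul c J _ h => rw [Pi.smul_apply, real_inner_smul_left, h, mul_zero]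

end Splitting

end JacobiSplitting

theorem theoremC {n : ℕ} {M : Type*} [EMetricSpace M]
    [ChartedSpace (EuclideanSpace ℝ (Fin n)) M] [IsManifold (𝓡 n) ∞ M]
    [Bundle.RiemannianBundle (fun x : M => TangentSpace (𝓡 n) x)]
    [IsContMDiffRiemannianBundle (𝓡 n) ∞ (EuclideanSpace ℝ (Fin n))
      (fun x : M => TangentSpace (𝓡 n) x)]
    [IsRiemannianManifold (𝓡 n) M] [CompleteSpace M]
    (k : ℕ) (hk : 1 ≤ k)
    (γ : ℝ → M) (hγ : JacobiSplitting.IsUnitSpeedGeodesic n γ)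
    (hRic : JacobiSplitting.RicNonneg n k γ)
    (Λ : Submodule ℝ (∀ t, TangentSpace (𝓡 n) (γ t)))
    (hdim : Module.finrank ℝ Λ + 1 = n)
    (hJacobi : ∀ J ∈ Λ, JacobiSplitting.IsJacobiField γ J)
    (hnormal : ∀ J ∈ Λ, ∀ t, inner ℝ (J t) (JacobiSplitting.velocity n γ t) = 0)
    (hS : JacobiSplitting.RiccatiSelfAdjoint γ Λ) :
    ((Module.finrank ℝ (JacobiSplitting.vanishingSpan γ Λ) : ℤ) ≤ n - k - 1 →
      JacobiSplitting.vanishingSpan γ Λ ⊔ (Λ ⊓ JacobiSplitting.parallelFields γ) = Λ ∧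
      Disjoint (JacobiSplitting.vanishingSpan γ Λ) (Λ ⊓ JacobiSplitting.parallelFields γ) ∧
      ∀ Z ∈ JacobiSplitting.vanishingSpan γ Λ, ∀ P ∈ Λ ⊓ JacobiSplitting.parallelFields γ,
        ∀ t, inner ℝ (Z t) (P t) = 0) ∧
    (JacobiSplitting.RicPos n k γ →
      (n : ℤ) - k ≤ Module.finrank ℝ (JacobiSplitting.vanishingSpan γ Λ)) := by

  obtain ⟨D⟩ := JacobiSplitting.exists_jacobiDerivs hJacobi
  have hfin := D.finiteDimensional hγ
  have hG := D.hasNonnegRicci hγ hS hRic hdim hnormal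
  have hle := JacobiSplitting.vanishingSpan_le Λ
  set Z := (JacobiSplitting.vanishingSpan γ Λ).comap Λ.subtype with hZdef
  have hZrank : Module.finrank ℝ Z = Module.finrank ℝ (JacobiSplitting.vanishingSpan γ Λ) :=
    (Submodule.comapSubtypeEquivOfLe hle).finrank_eq
  have hZ : ∀ t a, (D.toLagrangianFamily hγ hS).ev t a = 0 → a ∈ Z := fun t a h =>
    Submodule.subset_span ⟨a.2, t, h⟩
  refine ⟨fun hdimZ => ⟨le_antisymm (sup_le hle inf_le_left) fun J hJ => ?_, ?_, ?_⟩,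
    fun hpos => ?_⟩
  · obtain ⟨P, hPZ, hP⟩ := D.exists_parallel hγ hS hdim hnormal Z ⟨J, hJ⟩
      -- Since `dim Λ = n - 1`, the bound `dim Z ≤ n - k - 1` is `dim Z + k ≤ dim Λ`.
      fun t => hG.exists_lift hk hZ (by omega) t _
    exact Submodule.mem_sup.2 ⟨J - P.1, hPZ, P.1, ⟨P.2, hP⟩, sub_add_cancel _ _⟩
  · rw [Submodule.disjoint_def]
    intro J hJZ hJP
    funext t
    exact (inner_self_eq_zero (𝕜 := ℝ)).1
      (JacobiSplitting.inner_eq_zero_of_mem_vanishingSpan hγ D hS hJP.1 hJP.2 hJZ t)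
  · exact fun J hJ P hP t =>
      JacobiSplitting.inner_eq_zero_of_mem_vanishingSpan hγ D hS hP.1 hP.2 hJ t
  · have h := hG.lt_of_pos hk hZ fun t w hw hn => by
      have h := hpos t w (JacobiSplitting.orthonormal_cons_velocity hγ hw hn) (γ t)
        (mem_chart_source _ _)
      simp only [JacobiSplitting.sectionalCurvature_eq hγ (hw.1 _) (hn _)] at h
      exact h
    omega
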